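/- **Gauge invariance of the dressed field.** Let $\mathfrak g$ be a Lie algebra of compact type, realized as a real space of hermitean $N\times N$ matrices closed under $i[\cdot,\cdot]$. Let $c^\mu$ be a real vector-valued distribution on $\mathbb R^{1,3}$ with $\partial_\mu c^\mu=\delta$, and let $I_c^\mu(v_\mu)(x)=\int d^4y\,c^\mu(y)\,v_\mu(x+y)$ denote string integration, defined on a space $V$ of smooth vector fields of sufficiently rapid decay with values in a space $S$ of smooth functions. Here "sufficiently rapid decay" means: $V$ contains all smooth compactly supported vector fields; components of elements of $V$ lie in $S$; $S\cdot S\subset S$, $S\cdot V\subset V$, $\partial S\subset V$, $\partial_\nu V\subset V$, $I_c(V)\subset S$; $S$ and $V$ are translation invariant; $c$ is linear on $V$ and may be differentiated along translations; and $\int c^\mu\partial_\mu f=-f(0)$ for $f\in S$. All fields are formal power series in the coupling constant $g$. A potential $A=(A_\mu)$ is a formal power series in $g$ of $\mathfrak g$-valued vector fields in $V$. Fields are functionals of $A$ with the pointwise (Wick) product. $\mathcal S^{\mathfrak g}$ is the smallest real space of such functionals that contains $I_c^\nu(\mathrm{ad}_{is_k}\cdots\mathrm{ad}_{is_1}(A_\nu))$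 ($k\ge0$) and $I_c^\nu(\mathrm{ad}_{is_k}\cdots\mathrm{ad}_{is_1}(\partial_\nu s_0))$ ($k\ge1$) whenever $s_0,\dots,s_k\in\mathcal S^{\mathfrak g}$, and $\mathcal V^{\mathfrak g}$ is the real span of the vector fields $\mathrm{ad}_{is_k}\cdots\mathrm{ad}_{is_1}(A_\nu)$ and $\mathrm{ad}_{is_k}\cdots\mathrm{ad}_{is_1}(\partial_\nu s_0)$ ($k\ge0$, $s_j\in\mathcal S^{\mathfrak g}$). Let $W=W[A,I_c]=e^{i\gamma}$ be the dressing factor: $\gamma\in g\,\mathcal S^{\mathfrak g}[[g]]$ is the solution, which exists and is unique, of $$I_c^\mu\big(W(gA_\mu+i\partial_\mu)W^{-1}\big)=0 .$$ A gauge function is $\theta=e^{ig\lambda}$, where $\lambda$ is a formal power series in $g$ of $\mathfrak g$-valued functions with entries in $S$; it acts by $A\mapsto A^\theta:=\theta^{-1}(A+ig^{-1}\partial)\theta$, which is again a potential, and on functionals by $X[A]\mapsto X[A^\theta]$. Then $$W[A^\theta,I_c](x)=W[A,I_c](x)\,\theta(x).$$ Consequently, $A^{W^{-1}}=W(A+ig^{-1}\partial)W^{-1}$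 is gauge invariant. Moreover, let $A_\mu(c)=I_c^\nu(\partial_\mu A_\nu-\partial_\nu A_\mu)$ and, for $\alpha\in g\,\mathcal V^{\mathfrak g}[[g]]$, let $\omega$ be the (tree-level obstruction) map of the mediator field $U^\mu=\langle F^{\mu\nu}|\alpha_\nu\rangle$, that is, the derivation of functionals of $A$ in the direction $\alpha[A]$, so that $\omega(A_\nu)=\alpha_\nu$. There is an $\alpha$ with $$e^{\omega}(A_\mu(c))=A^{W^{-1}}_\mu=W(A_\mu+ig^{-1}\partial_\mu)W^{-1},$$ and for every such $\alpha$ the dressed field $e^{\omega}(A_\mu(c))$ is gauge invariant: its values at $A^\theta$ and at $A$ coincide. -/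

import Mathlib

open scoped ContDiff

noncomputable section

/-! ### Spacetime and string integration -/

/-- Points of spacetime, in linear coordinates `x^0, …, x^3`. -/
abbrev Spacetime : Type := Fin 4 → ℝ

/-- The partial derivative `∂_μ f` of a real function. -/
def pd (μ : Fin 4) (f : Spacetime → ℝ) : Spacetime → ℝ :=
  fun x => fderiv ℝ f x (Pi.single μ 1)

/-- The gradient `(∂_μ f)_μ` of a real function. -/
def grad (f : Spacetime → ℝ) : Fin 4 → Spacetime → ℝ := fun μ => pd μ f

/-- The shiftField `y ↦ v (x + y)` of a real vector field. -/
def shiftField (x : Spacetime) (v : Fin 4 → Spacetime → ℝ) : Fin 4 → Spacetime → ℝ :=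
  fun μ y => v μ (x + y)

/-- A real vector-valued distribution `c^μ` on spacetime with `∂_μ c^μ = δ`, together with spaces
`S` of functions and `V` of vector fields that decay rapidly enough for string integration with `c`.
The number `c v` stands for `∫ d⁴y c^μ(y) v_μ(y)`; only its values on `V` matter.
How fast the elements of `S` and `V` have to decay depends on `c` (on its support, or on its own
decay) and is left open; for instance, if `c` is any distribution supported in a closed convex
cone `K` containing no line, one may take for `S` the smooth functions supported in some `B - K`
with `B` compact, and for `V` the vector fields with components in `S`. -/
structure StringDistribution where
  /-- scalar functions of sufficiently rapid decay -/
  S : Submodule ℝ (Spacetime → ℝ)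
  /-- vector fields of sufficiently rapid decay -/
  V : Submodule ℝ (Fin 4 → Spacetime → ℝ)
  /-- the pairing of the distribution with vector fields -/
  c : (Fin 4 → Spacetime → ℝ) → ℝ
  smooth : ∀ f ∈ S, ContDiff ℝ ∞ f
  component_mem : ∀ v ∈ V, ∀ μ, v μ ∈ S
  test_mem : ∀ v : Fin 4 → Spacetime → ℝ,
    (∀ μ, ContDiff ℝ ∞ (v μ) ∧ HasCompactSupport (v μ)) → v ∈ V
  mul_mem_S : ∀ f ∈ S, ∀ h ∈ S, f * h ∈ S
  mul_mem_V : ∀ f ∈ S, ∀ v ∈ V, (fun μ => f * v μ) ∈ V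
  grad_mem : ∀ f ∈ S, grad f ∈ V
  pd_mem : ∀ v ∈ V, ∀ ν, (fun μ => pd ν (v μ)) ∈ V
  translate_mem_S : ∀ f ∈ S, ∀ x, (fun y => f (x + y)) ∈ S
  translate_mem_V : ∀ v ∈ V, ∀ x, shiftField x v ∈ V
  c_add : ∀ v ∈ V, ∀ w ∈ V, c (v + w) = c v + c w
  c_smul : ∀ r : ℝ, ∀ v ∈ V, c (r • v) = r * c v
  /-- weak continuity along translations -/
  c_translate : ∀ v ∈ V, ∀ ν, HasDerivAt (fun t : ℝ => c (shiftField (Pi.single ν t) v))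
    (c (fun μ => pd ν (v μ))) 0
  /-- string integrals of rapidly decaying vector fields are admissible scalar functions -/
  string_mem : ∀ v ∈ V, (fun x => c (shiftField x v)) ∈ S
  /-- `∂_μ c^μ = δ` in the sense of distributions -/
  div_c : ∀ f ∈ S, c (grad f) = - f 0

/-- String integration `I_c^μ(v_μ)(x) = ∫ d⁴y c^μ(y) v_μ(x + y)`. -/
def StringDistribution.string (D : StringDistribution) (v : Fin 4 → Spacetime → ℝ) :
    Spacetime → ℝ :=
  fun x => D.c (shiftField x v)

/-! ### Matrix-valued functions and power series in the coupling constant -/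

/-- A Lie algebra of compact type, in a faithful unitary representation and in the physicists'
convention: a real space of hermitean matrices that is closed under `i[·,·]`. -/
def IsCompactLieAlgebra {n : Type} [Fintype n] (𝔤 : Submodule ℝ (Matrix n n ℂ)) : Prop :=
  (∀ X ∈ 𝔤, X.IsHermitian) ∧ ∀ X ∈ 𝔤, ∀ Y ∈ 𝔤, Complex.I • (X * Y - Y * X) ∈ 𝔤

/-- Matrix-valued functions on spacetime, with the pointwise product. -/
abbrev MatFun (n : Type) : Type := Spacetime → Matrix n n ℂ

/-- Formal power series in the coupling constant `g = PowerSeries.X`. -/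
abbrev MatSeries (n : Type) : Type := PowerSeries (MatFun n)

section

variable {n : Type} [Fintype n] [DecidableEq n]

/-- The real part of a matrix entry, as a function on spacetime. -/
def reEntry (i j : n) (f : MatFun n) : Spacetime → ℝ := fun x => (f x i j).re

/-- The imaginary part of a matrix entry, as a function on spacetime. -/
def imEntry (i j : n) (f : MatFun n) : Spacetime → ℝ := fun x => (f x i j).im

/-- `∂_μ` on matrix-valued functions. -/
def pdMat (μ : Fin 4) (f : MatFun n) : MatFun n :=
  fun x => Matrix.of fun i j => ⟨pd μ (reEntry i j f) x, pd μ (imEntry i j f) x⟩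

/-- `I_c^μ(v_μ)` for matrix-valued vector fields. -/
def stringMat (D : StringDistribution) (v : Fin 4 → MatFun n) : MatFun n :=
  fun x => Matrix.of fun i j =>
    ⟨D.string (fun μ => reEntry i j (v μ)) x, D.string (fun μ => imEntry i j (v μ)) x⟩

/-- `∂_μ` on power series, coefficient by coefficient. -/
def pdSeries (μ : Fin 4) (F : MatSeries n) : MatSeries n :=
  PowerSeries.mk fun m => pdMat μ (PowerSeries.coeff m F)

/-- `I_c^μ(v_μ)` on power series, coefficient by coefficient. -/
def stringSeries (D : StringDistribution) (v : Fin 4 → MatSeries n) : MatSeries n :=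
  PowerSeries.mk fun m => stringMat D fun μ => PowerSeries.coeff m (v μ)

/-- Division by the coupling constant: `g⁻¹ F`, for `F` without term of order `g^0`. -/
def divCoupling (F : MatSeries n) : MatSeries n :=
  PowerSeries.mk fun m => PowerSeries.coeff (m + 1) F

/-- `exp F = ∑ F^k / k!`, for `F` without term of order `g^0`
(so that only `k ≤ m` contributes to the order `g^m`). -/
def expSeries (F : MatSeries n) : MatSeries n :=
  PowerSeries.mk fun m =>
    ∑ k ∈ Finset.range (m + 1), ((k.factorial : ℂ)⁻¹) • PowerSeries.coeff m (F ^ k)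

/-- `𝔤`-valued scalar functions of sufficiently rapid decay. -/
def IsLieScalar (D : StringDistribution) (𝔤 : Submodule ℝ (Matrix n n ℂ)) (s : MatFun n) : Prop :=
  (∀ x, s x ∈ 𝔤) ∧ ∀ i j, reEntry i j s ∈ D.S ∧ imEntry i j s ∈ D.S

/-- `𝔤`-valued vector fields of sufficiently rapid decay. -/
def IsLieVector (D : StringDistribution) (𝔤 : Submodule ℝ (Matrix n n ℂ)) (v : Fin 4 → MatFun n) :
    Prop :=
  (∀ μ x, v μ x ∈ 𝔤) ∧
    ∀ i j, (fun μ => reEntry i j (v μ)) ∈ D.V ∧ (fun μ => imEntry i j (v μ)) ∈ D.V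

/-- Configurations of the gauge potential `A_μ` (off shell). Power series in `g` are admitted
because gauge transformations involve `g`. -/
def IsPotential (D : StringDistribution) (𝔤 : Submodule ℝ (Matrix n n ℂ))
    (A : Fin 4 → MatSeries n) : Prop :=
  ∀ m, IsLieVector D 𝔤 fun μ => PowerSeries.coeff m (A μ)

/-- Parameters `λ` of the gauge functions `θ = exp(i g λ)`. -/
def IsGaugeParameter (D : StringDistribution) (𝔤 : Submodule ℝ (Matrix n n ℂ))
    (l : MatSeries n) : Prop :=
  ∀ m, IsLieScalar D 𝔤 (PowerSeries.coeff m l)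

/-- The gauge function `θ = exp(i g λ)`. -/
def gaugeFunction (l : MatSeries n) : MatSeries n :=
  expSeries (Complex.I • (PowerSeries.X * l))

/-- The gauge transformation `A^θ = θ⁻¹ (A + i g⁻¹ ∂) θ`. -/
def gaugeTransform (θ : MatSeries n) (A : Fin 4 → MatSeries n) : Fin 4 → MatSeries n :=
  fun μ => Ring.inverse θ * A μ * θ + Complex.I • divCoupling (Ring.inverse θ * pdSeries μ θ)

end

/-! ### Fields as functionals of the gauge potential

Under the (commutative) Wick product, the fields generated by `A`, `∂` and `I_c` are functionals
`X[A]` of the potential, with the pointwise product. A gauge transformation acts on them by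
`X[A] ↦ X[A^θ]`. -/

/-- Scalar fields, as functionals of `A`. -/
abbrev ScalarField (n : Type) : Type := (Fin 4 → MatSeries n) → MatSeries n

/-- Vector fields, as functionals of `A`. -/
abbrev VectorField (n : Type) : Type := (Fin 4 → MatSeries n) → Fin 4 → MatSeries n

section

variable {n : Type} [Fintype n] [DecidableEq n]

/-- `ad_{is}(v)_μ = i[s, v_μ]`. -/
def adField (s : ScalarField n) (v : VectorField n) : VectorField n :=
  fun A μ => Complex.I • (s A * v A μ - v A μ * s A)

/-- `ad_{i s_k} ⋯ ad_{i s_1}(v)` for the list `[s_k, …, s_1]`. -/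
def adChain (l : List (ScalarField n)) (v : VectorField n) : VectorField n :=
  l.foldr adField v

/-- The field `∂_μ s`. -/
def gradField (s : ScalarField n) : VectorField n := fun A μ => pdSeries μ (s A)

/-- The field `I_c^μ(v_μ)`. -/
def stringField (D : StringDistribution) (v : VectorField n) : ScalarField n :=
  fun A => stringSeries D (v A)

/-- The field `A_μ` itself. -/
def potentialField : VectorField n := fun A => A

/-- The smallest real space `𝒮^𝔤` of scalar fields that contains
`I_c^ν(ad_{i s_k} ⋯ ad_{i s_1}(A_ν))` for `k ≥ 0` and
`I_c^ν(ad_{i s_k} ⋯ ad_{i s_1}(∂_ν s_0))` for `k ≥ 1`, whenever all `s_j` belong to it. -/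
inductive InS (D : StringDistribution) : ScalarField n → Prop
  | zero : InS D 0
  | add (s t : ScalarField n) : InS D s → InS D t → InS D (s + t)
  | smul (r : ℝ) (s : ScalarField n) : InS D s → InS D (r • s)
  | string_A (l : List (ScalarField n)) : (∀ s ∈ l, InS D s) →
      InS D (stringField D (adChain l potentialField))
  | string_grad (l : List (ScalarField n)) (s₀ : ScalarField n) : l ≠ [] → (∀ s ∈ l, InS D s) →
      InS D s₀ → InS D (stringField D (adChain l (gradField s₀)))

/-- The smallest real space `𝒱^𝔤` of vector fields that contains
`ad_{i s_k} ⋯ ad_{i s_1}(A_ν)` and `ad_{i s_k} ⋯ ad_{i s_1}(∂_ν s_0)` for `k ≥ 0` and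
`s_j ∈ 𝒮^𝔤`. -/
inductive InV (D : StringDistribution) : VectorField n → Prop
  | zero : InV D 0
  | add (v w : VectorField n) : InV D v → InV D w → InV D (v + w)
  | smul (r : ℝ) (v : VectorField n) : InV D v → InV D (r • v)
  | ad_A (l : List (ScalarField n)) : (∀ s ∈ l, InS D s) → InV D (adChain l potentialField)
  | ad_grad (l : List (ScalarField n)) (s₀ : ScalarField n) : (∀ s ∈ l, InS D s) →
      InS D s₀ → InV D (adChain l (gradField s₀))

/-- The power series `∑_k g^k F_k`, where the `F_k` may themselves depend on `g`. -/
def sumSeries (F : ℕ → MatSeries n) : MatSeries n :=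
  PowerSeries.mk fun m => ∑ p ∈ Finset.HasAntidiagonal.antidiagonal m, PowerSeries.coeff p.2 (F p.1)

/-- Membership in `g 𝒮^𝔤[[g]]`, for functionals of admissible potentials. -/
def InGSeriesS (D : StringDistribution) (𝔤 : Submodule ℝ (Matrix n n ℂ)) (γ : ScalarField n) :
    Prop :=
  ∃ a : ℕ → ScalarField n, (∀ k, InS D (a k)) ∧ a 0 = 0 ∧
    ∀ A, IsPotential D 𝔤 A → γ A = sumSeries fun k => a k A

/-- Membership in `g 𝒱^𝔤[[g]]`, for functionals of admissible potentials. -/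
def InGSeriesV (D : StringDistribution) (𝔤 : Submodule ℝ (Matrix n n ℂ)) (α : VectorField n) :
    Prop :=
  ∃ a : ℕ → VectorField n, (∀ k, InV D (a k)) ∧ a 0 = 0 ∧
    ∀ A, IsPotential D 𝔤 A → ∀ μ, α A μ = sumSeries fun k => a k A μ

/-- `W = exp(iγ)`. -/
def dressingFactor (γ : ScalarField n) : ScalarField n :=
  fun A => expSeries (Complex.I • γ A)

/-- `γ ∈ g 𝒮^𝔤[[g]]` and `W = exp(iγ)` satisfies `I_c^μ(W (g A_μ + i ∂_μ) W⁻¹) = 0`. -/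
def IsDressingExponent (D : StringDistribution) (𝔤 : Submodule ℝ (Matrix n n ℂ))
    (γ : ScalarField n) : Prop :=
  InGSeriesS D 𝔤 γ ∧ ∀ A, IsPotential D 𝔤 A →
    stringSeries D (fun μ =>
      dressingFactor γ A * (PowerSeries.X * A μ) * Ring.inverse (dressingFactor γ A) +
        Complex.I • (dressingFactor γ A * pdSeries μ (Ring.inverse (dressingFactor γ A)))) = 0

/-- The operator-valued gauge transform `A^{W⁻¹} = W (A + i g⁻¹ ∂) W⁻¹`. -/
def dressedPotential (γ : ScalarField n) : VectorField n :=
  fun A => gaugeTransform (Ring.inverse (dressingFactor γ A)) A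

/-- The field strength `F_{μν} = ∂_μ A_ν - ∂_ν A_μ` of the free theory. -/
def fieldStrength (A : Fin 4 → MatSeries n) (μ ν : Fin 4) : MatSeries n :=
  pdSeries μ (A ν) - pdSeries ν (A μ)

/-- The string-localized potential `A_μ(c) = I_c^ν(F_{μν})`. -/
def stringPotential (D : StringDistribution) : VectorField n :=
  fun A μ => stringSeries D (fieldStrength A μ)

/-- The obstruction map `ω_U` of the mediator field `U^μ = ⟨F^{μν} | α_ν⟩`, at tree level.
The two-point obstruction of `F^{μν}` and `A^κ` is `i O_μ(F^{μν}(x'), A^κ(x)) = η^{νκ} δ(x' - x)`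
and `α_ν` is inert, so that `ω_U` is the derivation `∫ dx' ⟨α_ν(x') | δ/δA_ν(x')⟩`
with `ω_U(A_ν) = α_ν`: the derivative of functionals of `A` in the direction `α[A]`. -/
def obstruction (α : VectorField n) (X : VectorField n) : VectorField n :=
  fun A μ => PowerSeries.mk fun m x => Matrix.of fun i j =>
    deriv (fun ε : ℝ => PowerSeries.coeff m (X (A + ε • α A) μ) x i j) 0

/-- The flow `e^{ω_U} = ∑ ω_U^k / k!`, for `α` without term of order `g^0`
(so that only `k ≤ m` contributes to the order `g^m`). -/
def expObstruction (α : VectorField n) (X : VectorField n) : VectorField n :=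
  fun A μ => PowerSeries.mk fun m =>
    ∑ k ∈ Finset.range (m + 1),
      ((k.factorial : ℂ)⁻¹) • PowerSeries.coeff m ((obstruction α)^[k] X A μ)

/-- `U^μ = ⟨F^{μν} | α_ν⟩` with `α ∈ g 𝒱^𝔤[[g]]` generates the dressing transformation
`e^{ω_U}(A_μ(c)) = W (A_μ + i g⁻¹ ∂_μ) W⁻¹`. -/
def GeneratesDressing (D : StringDistribution) (𝔤 : Submodule ℝ (Matrix n n ℂ))
    (γ : ScalarField n) (α : VectorField n) : Prop :=
  InGSeriesV D 𝔤 α ∧ ∀ A, IsPotential D 𝔤 A →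
    expObstruction α (stringPotential D) A = dressedPotential γ A

end

end

/-!
Writing `B = gA`, a unit `U` acts on connection forms by `U · B = U B U⁻¹ + i U ∂U⁻¹`, and
`g A^θ = θ⁻¹ · (g A)`. If `I_c(B) = 0 = I_c(U · B)` with `B = O(g)` and `U = 1 + O(g)`, then
`U = 1`: since `I_c(∂f) = -f`, the transformation law expresses `U - 1` by its products with forms
of order `g`, so that `U - 1` vanishes to all orders. Hence the dressing factor is unique, and as
`W[A^θ] θ⁻¹` solves the equation at `A`, it is `W[A]`.

For existence, let `γ = g I_c(Φ)`. The dressed potential is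
`∑_k ad^k(A) / k! + ∑_k ad^k(∂ I_c(Φ)) / (k + 1)!` with `ad` of order `g`, so it can be equated with
`Φ + ∂ I_c(Φ)` by solving for `Φ` recursively in `g`; and `I_c` annihilates `Φ + ∂ I_c(Φ)`. Finally
`A(c) = A + ∂ I_c(A)`, and the linear map `v ↦ v + ∂ I_c(v)` commutes with `ω`, so it suffices to
solve `e^ω(A) = Φ`, which is again a recursion in `g`.
-/

open scoped ContDiff

noncomputable section

/-! ### Real string integration -/

namespace StringDistribution

variable (D : StringDistribution)

lemma hasFDerivAt {f : Spacetime → ℝ} (hf : f ∈ D.S) (x : Spacetime) :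
    HasFDerivAt f (fderiv ℝ f x) x :=
  ((D.smooth f hf).differentiable (by simp)).differentiableAt.hasFDerivAt

lemma string_add {v w : Fin 4 → Spacetime → ℝ} (hv : v ∈ D.V) (hw : w ∈ D.V) :
    D.string (v + w) = D.string v + D.string w :=
  funext fun x => D.c_add _ (D.translate_mem_V v hv x) _ (D.translate_mem_V w hw x)

lemma string_smul (r : ℝ) {v : Fin 4 → Spacetime → ℝ} (hv : v ∈ D.V) :
    D.string (r • v) = r • D.string v :=
  funext fun x => D.c_smul r _ (D.translate_mem_V v hv x)

/-- String integration as a linear map on the vector fields of rapid decay. -/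
def stringLinear : D.V →ₗ[ℝ] Spacetime → ℝ where
  toFun v := D.string v
  map_add' v w := D.string_add v.2 w.2
  map_smul' r v := D.string_smul r v.2

lemma pd_translate (μ : Fin 4) (f : Spacetime → ℝ) (x : Spacetime) :
    pd μ (fun y => f (x + y)) = fun y => pd μ f (x + y) :=
  funext fun y => by simp only [pd, fderiv_comp_add_left]

lemma string_grad {f : Spacetime → ℝ} (hf : f ∈ D.S) : D.string (grad f) = -f := by
  funext x
  have hshift : shiftField x (grad f) = grad fun y => f (x + y) := by
    funext μ y
    simp only [shiftField, grad, pd_translate]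
  simp only [string, hshift, D.div_c _ (D.translate_mem_S f hf x), add_zero, Pi.neg_apply]

lemma pd_string {v : Fin 4 → Spacetime → ℝ} (hv : v ∈ D.V) (μ : Fin 4) :
    pd μ (D.string v) = D.string fun ν => pd μ (v ν) := by
  funext x
  have hline : HasDerivAt (fun t : ℝ => x + Pi.single μ t) (Pi.single μ (1 : ℝ)) 0 := by
    have := ((hasDerivAt_id (0 : ℝ)).smul_const (Pi.single μ (1 : ℝ) : Spacetime)).const_add x
    simpa [← Pi.single_smul] using this
  have hstring : HasFDerivAt (D.string v) (fderiv ℝ (D.string v) x)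
      (x + Pi.single μ (0 : ℝ)) := by
    rw [Pi.single_zero, add_zero]
    exact D.hasFDerivAt (D.string_mem v hv) x
  have hcomp : (D.string v ∘ fun t : ℝ => x + Pi.single μ t) =
      fun t : ℝ => D.c (shiftField (Pi.single μ t) (shiftField x v)) := by
    funext t
    refine congrArg D.c ?_
    funext ν y
    simp only [shiftField, add_assoc]
  have hshift : (fun ν => pd μ (shiftField x v ν)) = shiftField x fun ν => pd μ (v ν) :=
    funext fun ν => pd_translate μ (v ν) x
  have hleft := hstring.comp_hasDerivAt (0 : ℝ) hline
  have hright := D.c_translate _ (D.translate_mem_V v hv x) μ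
  rw [hcomp] at hleft
  rw [hshift] at hright
  exact hleft.unique hright

end StringDistribution

/-! ### Matrix-valued functions -/

section RapidDecay

variable {n : Type} (D : StringDistribution)

variable (n) in
/-- Matrix-valued functions whose entries decay rapidly. -/
def rapidMat : Submodule ℂ (MatFun n) where
  carrier := {s | ∀ i j, reEntry i j s ∈ D.S ∧ imEntry i j s ∈ D.S}
  zero_mem' _ _ := ⟨D.S.zero_mem, D.S.zero_mem⟩
  add_mem' hs ht i j := ⟨D.S.add_mem (hs i j).1 (ht i j).1, D.S.add_mem (hs i j).2 (ht i j).2⟩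
  smul_mem' a _ hs i j :=
    ⟨D.S.sub_mem (D.S.smul_mem a.re (hs i j).1) (D.S.smul_mem a.im (hs i j).2),
      D.S.add_mem (D.S.smul_mem a.re (hs i j).2) (D.S.smul_mem a.im (hs i j).1)⟩

variable (n) in
/-- Matrix-valued vector fields whose entries decay rapidly. -/
def rapidVec : Submodule ℂ (Fin 4 → MatFun n) where
  carrier := {v | ∀ i j, (fun μ => reEntry i j (v μ)) ∈ D.V ∧ (fun μ => imEntry i j (v μ)) ∈ D.V}
  zero_mem' _ _ := ⟨D.V.zero_mem, D.V.zero_mem⟩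
  add_mem' hs ht i j := ⟨D.V.add_mem (hs i j).1 (ht i j).1, D.V.add_mem (hs i j).2 (ht i j).2⟩
  smul_mem' a _ hs i j :=
    ⟨D.V.sub_mem (D.V.smul_mem a.re (hs i j).1) (D.V.smul_mem a.im (hs i j).2),
      D.V.add_mem (D.V.smul_mem a.re (hs i j).2) (D.V.smul_mem a.im (hs i j).1)⟩

variable {D} {s t : MatFun n} {v w : Fin 4 → MatFun n}

lemma pdMat_mem_rapidVec (hs : s ∈ rapidMat n D) : (fun μ => pdMat μ s) ∈ rapidVec n D :=
  fun i j => ⟨D.grad_mem _ (hs i j).1, D.grad_mem _ (hs i j).2⟩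

lemma stringMat_mem_rapidMat (hv : v ∈ rapidVec n D) : stringMat D v ∈ rapidMat n D :=
  fun i j => ⟨D.string_mem _ (hv i j).1, D.string_mem _ (hv i j).2⟩

lemma stringMat_grad (hs : s ∈ rapidMat n D) : stringMat D (fun μ => pdMat μ s) = -s := by
  funext x
  ext i j
  exact Complex.ext (congrFun (D.string_grad (hs i j).1) x) (congrFun (D.string_grad (hs i j).2) x)

lemma pdMat_stringMat (hv : v ∈ rapidVec n D) (μ : Fin 4) :
    pdMat μ (stringMat D v) = stringMat D fun ν => pdMat μ (v ν) := by
  funext x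
  ext i j
  exact Complex.ext (congrFun (D.pd_string (hv i j).1 μ) x)
    (congrFun (D.pd_string (hv i j).2 μ) x)

lemma pdMat_mem_rapidVec_of_mem (hv : v ∈ rapidVec n D) (ν : Fin 4) :
    (fun μ => pdMat ν (v μ)) ∈ rapidVec n D :=
  fun i j => ⟨D.pd_mem _ (hv i j).1 ν, D.pd_mem _ (hv i j).2 ν⟩

lemma stringMat_add (hv : v ∈ rapidVec n D) (hw : w ∈ rapidVec n D) :
    stringMat D (v + w) = stringMat D v + stringMat D w := by
  funext x
  ext i j
  exact Complex.ext (congrFun (D.string_add (hv i j).1 (hw i j).1) x)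
    (congrFun (D.string_add (hv i j).2 (hw i j).2) x)

section Mul

variable [Fintype n]

lemma reEntry_mul (f h : MatFun n) (i j : n) : reEntry i j (f * h) =
    ∑ k, (reEntry i k f * reEntry k j h - imEntry i k f * imEntry k j h) := by
  funext x
  simp [reEntry, imEntry, Matrix.mul_apply, Finset.sum_apply]

lemma imEntry_mul (f h : MatFun n) (i j : n) : imEntry i j (f * h) =
    ∑ k, (reEntry i k f * imEntry k j h + imEntry i k f * reEntry k j h) := by
  funext x
  simp [reEntry, imEntry, Matrix.mul_apply, Finset.sum_apply]

lemma mul_mem_rapidMat (hs : s ∈ rapidMat n D) (ht : t ∈ rapidMat n D) :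
    s * t ∈ rapidMat n D := by
  intro i j
  rw [reEntry_mul, imEntry_mul]
  exact ⟨D.S.sum_mem fun k _ => D.S.sub_mem (D.mul_mem_S _ (hs i k).1 _ (ht k j).1)
      (D.mul_mem_S _ (hs i k).2 _ (ht k j).2),
    D.S.sum_mem fun k _ => D.S.add_mem (D.mul_mem_S _ (hs i k).1 _ (ht k j).2)
      (D.mul_mem_S _ (hs i k).2 _ (ht k j).1)⟩

lemma mul_mem_rapidVec (hs : s ∈ rapidMat n D) (hv : v ∈ rapidVec n D) :
    (fun μ => s * v μ) ∈ rapidVec n D := by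
  intro i j
  simp only [reEntry_mul, imEntry_mul]
  constructor
  · convert D.V.sum_mem fun (k : n) (_ : k ∈ Finset.univ) =>
      D.V.sub_mem (D.mul_mem_V _ (hs i k).1 _ (hv k j).1) (D.mul_mem_V _ (hs i k).2 _ (hv k j).2)
    simp [Finset.sum_apply]
  · convert D.V.sum_mem fun (k : n) (_ : k ∈ Finset.univ) =>
      D.V.add_mem (D.mul_mem_V _ (hs i k).1 _ (hv k j).2) (D.mul_mem_V _ (hs i k).2 _ (hv k j).1)
    simp [Finset.sum_apply]

lemma mul_mem_rapidVec_right (hs : s ∈ rapidMat n D) (hv : v ∈ rapidVec n D) :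
    (fun μ => v μ * s) ∈ rapidVec n D := by
  intro i j
  simp only [reEntry_mul, imEntry_mul, mul_comm (reEntry i _ (v _)), mul_comm (imEntry i _ (v _))]
  constructor
  · convert D.V.sum_mem fun (k : n) (_ : k ∈ Finset.univ) =>
      D.V.sub_mem (D.mul_mem_V _ (hs k j).1 _ (hv i k).1) (D.mul_mem_V _ (hs k j).2 _ (hv i k).2)
    simp [Finset.sum_apply]
  · convert D.V.sum_mem fun (k : n) (_ : k ∈ Finset.univ) =>
      D.V.add_mem (D.mul_mem_V _ (hs k j).2 _ (hv i k).1) (D.mul_mem_V _ (hs k j).1 _ (hv i k).2)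
    simp [Finset.sum_apply]

end Mul

end RapidDecay

section RealFunctionals

variable {n : Type} {D : StringDistribution} {s : MatFun n} {v : Fin 4 → MatFun n}

lemma realFunctional_apply [Fintype n] [DecidableEq n] (f : Matrix n n ℂ →ₗ[ℝ] ℝ)
    (Y : Matrix n n ℂ) :
    f Y = ∑ i, ∑ j, (f (Matrix.single i j 1) * (Y i j).re +
      f (Matrix.single i j Complex.I) * (Y i j).im) := by
  have hentry : ∀ i j, Matrix.single i j (Y i j) =
      (Y i j).re • Matrix.single i j (1 : ℂ) + (Y i j).im • Matrix.single i j Complex.I := by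
    intro i j
    rw [Matrix.smul_single, Matrix.smul_single, ← Matrix.single_add]
    simp
  conv_lhs => rw [Matrix.matrix_eq_sum_single Y]
  simp only [hentry, map_sum, map_add, map_smul, smul_eq_mul, mul_comm]

lemma realFunctional_pdMat [Finite n] (f : Matrix n n ℂ →ₗ[ℝ] ℝ) (hs : s ∈ rapidMat n D) (μ : Fin 4)
    (x : Spacetime) : f (pdMat μ s x) = pd μ (fun y => f (s y)) x := by
  classical
  have := Fintype.ofFinite n
  have hderiv : HasFDerivAt (fun y => f (s y))
      (∑ i, ∑ j, (f (Matrix.single i j 1) • fderiv ℝ (reEntry i j s) x +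
        f (Matrix.single i j Complex.I) • fderiv ℝ (imEntry i j s) x)) x := by
    simp only [realFunctional_apply f (s _)]
    exact HasFDerivAt.fun_sum fun i _ => HasFDerivAt.fun_sum fun j _ =>
      ((D.hasFDerivAt (hs i j).1 x).const_mul _).add ((D.hasFDerivAt (hs i j).2 x).const_mul _)
  rw [realFunctional_apply f (pdMat μ s x), pd, hderiv.fderiv]
  simp [pdMat, pd]

lemma realFunctional_stringMat [Finite n] (f : Matrix n n ℂ →ₗ[ℝ] ℝ) (hv : v ∈ rapidVec n D)
    (x : Spacetime) : f (stringMat D v x) = D.string (fun μ y => f (v μ y)) x := by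
  classical
  have := Fintype.ofFinite n
  let w : D.V := ∑ i, ∑ j, (f (Matrix.single i j 1) • ⟨_, (hv i j).1⟩ +
    f (Matrix.single i j Complex.I) • ⟨_, (hv i j).2⟩)
  have hw : (w : Fin 4 → Spacetime → ℝ) = fun μ y => f (v μ y) := by
    funext μ y
    simp only [w, realFunctional_apply f (v μ y), Submodule.coe_sum, Submodule.coe_add,
      Submodule.coe_smul, Finset.sum_apply, Pi.add_apply, Pi.smul_apply, smul_eq_mul]
    rfl
  have hstring := congrFun (map_sum D.stringLinear (fun i => ∑ j, (f (Matrix.single i j 1) •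
    (⟨_, (hv i j).1⟩ : D.V) + f (Matrix.single i j Complex.I) • ⟨_, (hv i j).2⟩)) Finset.univ) x
  rw [← hw, realFunctional_apply]
  refine Eq.trans ?_ hstring.symm
  simp only [map_sum, map_add, map_smul, Finset.sum_apply, Pi.add_apply, Pi.smul_apply, smul_eq_mul]
  rfl

lemma mem_of_forall_realFunctional {𝔤 : Submodule ℝ (Matrix n n ℂ)} {Y : Matrix n n ℂ}
    (h : ∀ f : Matrix n n ℂ →ₗ[ℝ] ℝ, (∀ Z ∈ 𝔤, f Z = 0) → f Y = 0) : Y ∈ 𝔤 := by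
  by_contra hY
  obtain ⟨f, hf, hker⟩ := Submodule.exists_le_ker_of_notMem hY
  exact hf (h f fun Z hZ => hker hZ)

lemma stringMat_smul [Finite n] (a : ℂ) (hv : v ∈ rapidVec n D) :
    stringMat D (a • v) = a • stringMat D v := by
  have hentry (p : ℂ →ₗ[ℝ] ℝ) (x : Spacetime) (i j : n) :
      p (a * stringMat D v x i j) = D.string (fun μ y => p (a * v μ y i j)) x :=
    realFunctional_stringMat (D := D) (v := v) (x := x) (hv := hv)
      (p ∘ₗ LinearMap.mulLeft ℝ a ∘ₗ Matrix.entryLinearMap ℝ ℂ i j)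
  funext x
  ext i j
  exact Complex.ext (hentry Complex.reLm x i j).symm (hentry Complex.imLm x i j).symm

lemma stringMat_zero [Finite n] : stringMat D (0 : Fin 4 → MatFun n) = 0 := by
  simpa using stringMat_smul (D := D) 0 (rapidVec n D).zero_mem

end RealFunctionals

/-! ### Smooth matrix-valued functions -/

section SmoothMat

variable {n : Type}

lemma pdMat_const (μ : Fin 4) (Y : Matrix n n ℂ) : pdMat μ (fun _ => Y) = 0 := by
  funext x
  ext i j
  have hre : reEntry i j (fun _ => Y) = fun _ => (Y i j).re := rfl
  have him : imEntry i j (fun _ => Y) = fun _ => (Y i j).im := rfl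
  apply Complex.ext <;> simp [pdMat, pd, hre, him]

variable [Fintype n] [DecidableEq n]

variable (n) in
/-- Matrix-valued functions with smooth entries. -/
def smoothMat : Subalgebra ℂ (MatFun n) where
  carrier := {f | ∀ i j, ContDiff ℝ ∞ fun x => f x i j}
  add_mem' hf hh i j := (hf i j).add (hh i j)
  mul_mem' {f h} hf hh i j := by
    simp only [Pi.mul_apply, Matrix.mul_apply]
    exact ContDiff.sum fun k _ => (hf i k).mul (hh k j)
  algebraMap_mem' _ _ _ := contDiff_const

variable {f h : MatFun n}

lemma differentiableAt_of_mem_smoothMat (hf : f ∈ smoothMat n) (i j : n) (x : Spacetime) :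
    DifferentiableAt ℝ (fun x => f x i j) x :=
  ((hf i j).differentiable (by simp)).differentiableAt

lemma pdMat_apply (hf : f ∈ smoothMat n) (μ : Fin 4) (x : Spacetime) (i j : n) :
    pdMat μ f x i j = fderiv ℝ (fun y => f y i j) x (Pi.single μ 1) := by
  have hderiv := (differentiableAt_of_mem_smoothMat hf i j x).hasFDerivAt
  apply Complex.ext
  · exact congrArg (· (Pi.single μ 1)) (Complex.reCLM.hasFDerivAt.comp x hderiv).fderiv
  · exact congrArg (· (Pi.single μ 1)) (Complex.imCLM.hasFDerivAt.comp x hderiv).fderiv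

lemma mem_smoothMat_of_mem_rapidMat {D : StringDistribution} (hf : f ∈ rapidMat n D) :
    f ∈ smoothMat n := by
  intro i j
  have hentry : (fun x => f x i j) = fun x =>
      Complex.ofRealCLM (reEntry i j f x) + Complex.ofRealCLM (imEntry i j f x) * Complex.I :=
    funext fun x => (Complex.re_add_im _).symm
  rw [hentry]
  exact (Complex.ofRealCLM.contDiff.comp (D.smooth _ (hf i j).1)).add
    ((Complex.ofRealCLM.contDiff.comp (D.smooth _ (hf i j).2)).mul contDiff_const)

lemma pdMat_add (hf : f ∈ smoothMat n) (hh : h ∈ smoothMat n) (μ : Fin 4) :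
    pdMat μ (f + h) = pdMat μ f + pdMat μ h := by
  funext x
  ext i j
  simp only [Pi.add_apply, Matrix.add_apply, pdMat_apply (add_mem hf hh), pdMat_apply hf,
    pdMat_apply hh]
  rw [fderiv_fun_add (differentiableAt_of_mem_smoothMat hf i j x)
    (differentiableAt_of_mem_smoothMat hh i j x)]
  rfl

lemma pdMat_mul (hf : f ∈ smoothMat n) (hh : h ∈ smoothMat n) (μ : Fin 4) :
    pdMat μ (f * h) = pdMat μ f * h + f * pdMat μ h := by
  funext x
  ext i j
  have df := fun k => differentiableAt_of_mem_smoothMat hf i k x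
  have dh := fun k => differentiableAt_of_mem_smoothMat hh k j x
  simp only [pdMat_apply (mul_mem hf hh), Pi.add_apply, Pi.mul_apply, Matrix.add_apply,
    Matrix.mul_apply, pdMat_apply hf, pdMat_apply hh]
  rw [fderiv_fun_sum fun k _ => (df k).fun_mul (dh k), sum_apply, ← Finset.sum_add_distrib]
  refine Finset.sum_congr rfl fun k _ => ?_
  rw [fderiv_fun_mul (df k) (dh k)]
  simp only [add_apply, smul_apply, smul_eq_mul]
  ring

lemma pdMat_smul (a : ℂ) (hf : f ∈ smoothMat n) (μ : Fin 4) :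
    pdMat μ (a • f) = a • pdMat μ f := by
  have hconst : pdMat μ (a • 1 : MatFun n) = 0 := pdMat_const μ (a • 1)
  rw [← smul_one_mul a f, pdMat_mul ((smoothMat n).smul_mem (one_mem _) a) hf, hconst, zero_mul,
    zero_add, smul_one_mul]

lemma pdMat_sum {ι : Type*} (t : Finset ι) {F : ι → MatFun n} (hF : ∀ i, F i ∈ smoothMat n)
    (μ : Fin 4) : pdMat μ (∑ i ∈ t, F i) = ∑ i ∈ t, pdMat μ (F i) := by
  classical
  induction t using Finset.induction_on with
  | empty => exact pdMat_const μ 0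
  | insert a t ha ih =>
    rw [Finset.sum_insert ha, Finset.sum_insert ha, pdMat_add (hF a) (sum_mem fun i _ => hF i), ih]

end SmoothMat

/-! ### Fields with values in a bracket-closed space -/

section LieValued

variable {n : Type}

/-- Real spaces of matrices closed under `i[·,·]`: Lie algebras of matrices in the convention in
which a Lie algebra of compact type consists of hermitean matrices. -/
def IsBracketClosed [Fintype n] (𝔤 : Submodule ℝ (Matrix n n ℂ)) : Prop :=
  ∀ X ∈ 𝔤, ∀ Y ∈ 𝔤, Complex.I • (X * Y - Y * X) ∈ 𝔤

variable {D : StringDistribution} {𝔤 : Submodule ℝ (Matrix n n ℂ)} {s : MatFun n}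
  {v : Fin 4 → MatFun n}

lemma IsLieScalar.grad [Finite n] (hs : IsLieScalar D 𝔤 s) :
    IsLieVector D 𝔤 fun μ => pdMat μ s := by
  refine ⟨fun μ x => mem_of_forall_realFunctional fun f hf => ?_, pdMat_mem_rapidVec hs.2⟩
  have hzero : (fun y => f (s y)) = fun _ => 0 := funext fun y => hf _ (hs.1 y)
  rw [realFunctional_pdMat f hs.2, hzero]
  simp [pd]

lemma IsLieVector.string [Finite n] (hv : IsLieVector D 𝔤 v) : IsLieScalar D 𝔤 (stringMat D v) := by
  refine ⟨fun x => mem_of_forall_realFunctional fun f hf => ?_, stringMat_mem_rapidMat hv.2⟩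
  have hzero : (fun μ y => f (v μ y)) = ((0 : D.V) : Fin 4 → Spacetime → ℝ) :=
    funext fun μ => funext fun y => hf _ (hv.1 μ y)
  rw [realFunctional_stringMat f hv.2, hzero]
  exact congrFun (map_zero D.stringLinear) x

lemma IsLieVector.bracket [Fintype n] (h𝔤 : IsBracketClosed 𝔤) (hs : IsLieScalar D 𝔤 s)
    (hv : IsLieVector D 𝔤 v) : IsLieVector D 𝔤 fun μ => Complex.I • (s * v μ - v μ * s) :=
  ⟨fun μ x => h𝔤 _ (hs.1 x) _ (hv.1 μ x),
    (rapidVec n D).smul_mem Complex.I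
      ((rapidVec n D).sub_mem (mul_mem_rapidVec hs.2 hv.2) (mul_mem_rapidVec_right hs.2 hv.2))⟩

end LieValued

/-! ### Formal sums of power series -/

section FormalSum

open PowerSeries Finset

section Semiring

variable {R : Type*} [Semiring R] {a b : ℕ → R⟦X⟧}

/-- The sum `∑ a_k` of power series `a_k` of order at least `k`
(so that only `k ≤ m` contributes to the coefficient of degree `m`). -/
def formalSum (a : ℕ → R⟦X⟧) : R⟦X⟧ := mk fun m => ∑ k ∈ range (m + 1), coeff m (a k)

lemma coeff_formalSum (ha : ∀ k : ℕ, k ≤ (a k).order) {m N : ℕ} (h : m < N) :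
    coeff m (formalSum a) = ∑ k ∈ range N, coeff m (a k) := by
  rw [formalSum, coeff_mk]
  refine sum_subset (range_mono h) fun k _ hk => coeff_of_lt_order m ((ha k).trans_lt' ?_)
  exact_mod_cast Nat.lt_of_succ_le (not_lt.mp (mem_range.not.mp hk))

lemma formalSum_add : formalSum (fun k => a k + b k) = formalSum a + formalSum b := by
  ext1 m
  simp only [formalSum, coeff_mk, map_add, sum_add_distrib]

lemma formalSum_eq_single_zero (h : ∀ k, a (k + 1) = 0) : formalSum a = a 0 := by
  ext1 m
  simp only [formalSum, coeff_mk, sum_range_succ', h, map_zero, sum_const_zero, zero_add]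

lemma formalSum_X_mul (h₀ : a 0 = 0) (h : ∀ k, a (k + 1) = X * b k) :
    formalSum a = X * formalSum b := by
  ext1 m
  cases m with
  | zero => simp [formalSum, h₀]
  | succ m => simp only [formalSum, coeff_mk, sum_range_succ' _ (m + 1), h₀, h, map_zero, add_zero,
      coeff_succ_X_mul]

lemma coeff_mul_congr {φ φ' ψ ψ' : R⟦X⟧} {m : ℕ} (hφ : ∀ i ≤ m, coeff i φ = coeff i φ')
    (hψ : ∀ i ≤ m, coeff i ψ = coeff i ψ') : coeff m (φ * ψ) = coeff m (φ' * ψ') := by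
  simp only [coeff_mul]
  refine sum_congr rfl fun p hp => ?_
  rw [hφ _ (HasAntidiagonal.antidiagonal.fst_le hp), hψ _ (HasAntidiagonal.antidiagonal.snd_le hp)]

lemma formalSum_mul_formalSum (ha : ∀ k : ℕ, k ≤ (a k).order) (hb : ∀ k : ℕ, k ≤ (b k).order) :
    formalSum a * formalSum b = formalSum fun k => ∑ p ∈ antidiagonal k, a p.1 * b p.2 := by
  ext1 m
  have htrunc {c : ℕ → R⟦X⟧} (hc : ∀ k : ℕ, k ≤ (c k).order) (i : ℕ) (hi : i ≤ m) :
      coeff i (formalSum c) = coeff i (∑ k ∈ range (m + 1), c k) := by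
    rw [coeff_formalSum hc (Nat.lt_succ_of_le hi), map_sum]
  have hvanish (i j : ℕ) (hij : m < i + j) : coeff m (a i * b j) = 0 :=
    coeff_of_lt_order m (lt_of_lt_of_le (by exact_mod_cast hij)
      ((add_le_add (ha i) (hb j)).trans (le_order_mul _ _)))
  calc coeff m (formalSum a * formalSum b)
      = ∑ i ∈ range (m + 1), ∑ j ∈ range (m + 1), coeff m (a i * b j) := by
        rw [coeff_mul_congr (htrunc ha) (htrunc hb), sum_mul_sum]
        simp only [map_sum]
    _ = ∑ i ∈ range (m + 1), ∑ j ∈ range (m + 1 - i), coeff m (a i * b j) := by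
        refine sum_congr rfl fun i _ => (sum_subset (range_mono (Nat.sub_le _ _)) ?_).symm
        exact fun j _ hj => hvanish i j (by rw [mem_range] at hj; lia)
    _ = coeff m (formalSum fun k => ∑ p ∈ antidiagonal k, a p.1 * b p.2) := by
        rw [formalSum, coeff_mk, ← sum_range_diag_flip (m + 1) fun i j => coeff m (a i * b j)]
        simp only [map_sum, Nat.sum_antidiagonal_eq_sum_range_succ_mk]

lemma mul_formalSum (φ : R⟦X⟧) (ha : ∀ k : ℕ, k ≤ (a k).order) :
    φ * formalSum a = formalSum fun k => φ * a k := by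
  ext1 m
  have htrunc (i : ℕ) (hi : i ≤ m) :
      coeff i (formalSum a) = coeff i (∑ k ∈ range (m + 1), a k) := by
    rw [coeff_formalSum ha (Nat.lt_succ_of_le hi), map_sum]
  rw [coeff_mul_congr (fun _ _ => rfl) htrunc, mul_sum, map_sum, formalSum, coeff_mk]

end Semiring

lemma eq_zero_of_order_raising {R : Type*} [Semiring R] {φ : R⟦X⟧}
    (h : ∀ m : ℕ, m ≤ φ.order → (m + 1 : ℕ) ≤ φ.order) : φ = 0 := by
  have hle (m : ℕ) : m ≤ φ.order := by
    induction m with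
    | zero => exact zero_le
    | succ m ih => exact h m ih
  exact order_eq_top.mp (ENat.eq_top_iff_forall_ge.mpr hle)

end FormalSum

/-! ### Commutators and divided powers -/

section DividedPowers

open Finset

variable {R : Type*} [Ring R] [Algebra ℂ R]

/-- The commutator `v ↦ u v - v u` as a linear map. -/
def commutatorMap (u : R) : Module.End ℂ R := LinearMap.mulLeft ℂ u - LinearMap.mulRight ℂ u

lemma commutatorMap_apply (u v : R) : commutatorMap u v = u * v - v * u := rfl

/-- The divided power `u^k / k!`. -/
def dividedPower (u : R) (k : ℕ) : R := (k.factorial : ℂ)⁻¹ • u ^ k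

lemma dividedPower_zero (u : R) : dividedPower u 0 = 1 := by
  simp [dividedPower]

lemma inv_factorial_succ_smul {M : Type*} [AddCommGroup M] [Module ℂ M] (k : ℕ) (x : M) :
    (k + 1 : ℂ) • ((k + 1).factorial : ℂ)⁻¹ • x = (k.factorial : ℂ)⁻¹ • x := by
  rw [smul_smul, Nat.factorial_succ, Nat.cast_mul, mul_inv, Nat.cast_succ, ← mul_assoc,
    mul_inv_cancel₀ (Nat.cast_add_one_ne_zero k), one_mul]

lemma succ_smul_dividedPower_succ (u : R) (k : ℕ) :
    (k + 1 : ℂ) • dividedPower u (k + 1) = u * dividedPower u k := by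
  rw [dividedPower, inv_factorial_succ_smul, dividedPower, pow_succ', mul_smul_comm]

lemma succ_smul_dividedPower_succ' (u : R) (k : ℕ) :
    (k + 1 : ℂ) • dividedPower u (k + 1) = dividedPower u k * u := by
  rw [dividedPower, inv_factorial_succ_smul, dividedPower, pow_succ, smul_mul_assoc]

lemma succ_smul_sum_antidiagonal {M : Type*} [AddCommGroup M] [Module ℂ M] (f : ℕ → ℕ → M)
    (k : ℕ) : (k + 1 : ℂ) • ∑ p ∈ antidiagonal (k + 1), f p.1 p.2 =
      ∑ p ∈ antidiagonal k,
        ((p.1 + 1 : ℂ) • f (p.1 + 1) p.2 + (p.2 + 1 : ℂ) • f p.1 (p.2 + 1)) := by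
  have hsplit : (k + 1 : ℂ) • ∑ p ∈ antidiagonal (k + 1), f p.1 p.2 =
      ∑ p ∈ antidiagonal (k + 1), (p.1 : ℂ) • f p.1 p.2 +
        ∑ p ∈ antidiagonal (k + 1), (p.2 : ℂ) • f p.1 p.2 := by
    rw [smul_sum, ← sum_add_distrib]
    refine sum_congr rfl fun p hp => ?_
    rw [← add_smul, ← Nat.cast_add, mem_antidiagonal.mp hp, Nat.cast_succ]
  rw [hsplit, Nat.sum_antidiagonal_succ, Nat.sum_antidiagonal_succ', sum_add_distrib]
  simp

lemma eq_inv_factorial_smul_of_succ_smul {M : Type*} [AddCommGroup M] [Module ℂ M]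
    (T : Module.End ℂ M) {f : ℕ → M} (h : ∀ k : ℕ, (k + 1 : ℂ) • f (k + 1) = T (f k)) (k : ℕ) :
    f k = (k.factorial : ℂ)⁻¹ • (T ^ k) (f 0) := by
  induction k with
  | zero => simp
  | succ k ih =>
    have hk : (k + 1 : ℂ) ≠ 0 := Nat.cast_add_one_ne_zero k
    rw [← smul_right_injective M hk |>.eq_iff]
    simp only [h, inv_factorial_succ_smul, ih, map_smul, pow_succ', Module.End.mul_apply]

lemma sum_dividedPower_conj (u v : R) (k : ℕ) :
    ∑ p ∈ antidiagonal k, dividedPower u p.1 * (v * dividedPower (-u) p.2) =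
      (k.factorial : ℂ)⁻¹ • (commutatorMap u ^ k) v := by
  rw [eq_inv_factorial_smul_of_succ_smul (commutatorMap u) (k := k)
    (f := fun k => ∑ p ∈ antidiagonal k, dividedPower u p.1 * (v * dividedPower (-u) p.2))]
  · simp [dividedPower_zero]
  intro k
  rw [succ_smul_sum_antidiagonal fun i j => dividedPower u i * (v * dividedPower (-u) j), map_sum]
  refine sum_congr rfl fun p _ => ?_
  rw [← smul_mul_assoc, ← mul_smul_comm, ← mul_smul_comm, succ_smul_dividedPower_succ,
    succ_smul_dividedPower_succ', commutatorMap_apply]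
  noncomm_ring

lemma sum_dividedPower_mul_neg (u : R) (k : ℕ) :
    ∑ p ∈ antidiagonal (k + 1), dividedPower u p.1 * dividedPower (-u) p.2 = 0 := by
  have h := sum_dividedPower_conj u 1 (k + 1)
  have hcomm : commutatorMap u 1 = 0 := by simp [commutatorMap_apply]
  simpa only [one_mul, pow_succ, Module.End.mul_apply, hcomm, map_zero, smul_zero] using h

lemma succ_smul_sum_dividedPower_derivation {S : Subalgebra ℂ R} {δ : S →ₗ[ℂ] R}
    (hδ : ∀ a b : S, δ (a * b) = δ a * b + a * δ b) (u : S) (k : ℕ) :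
    (k + 1 : ℂ) • ∑ p ∈ antidiagonal (k + 1), dividedPower (u : R) p.1 * δ (dividedPower (-u) p.2) =
      commutatorMap (u : R)
          (∑ p ∈ antidiagonal k, dividedPower (u : R) p.1 * δ (dividedPower (-u) p.2)) -
        (∑ p ∈ antidiagonal k, dividedPower (u : R) p.1 * dividedPower (-u : R) p.2) * δ u := by
  have hcoe (j : ℕ) : ((dividedPower (-u) j : S) : R) = dividedPower (-u : R) j := by
    simp [dividedPower]
  rw [succ_smul_sum_antidiagonal fun i j => dividedPower (u : R) i * δ (dividedPower (-u) j),
    map_sum, sum_mul, ← sum_sub_distrib]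
  refine sum_congr rfl fun p _ => ?_
  rw [← smul_mul_assoc, ← mul_smul_comm, ← map_smul, succ_smul_dividedPower_succ,
    succ_smul_dividedPower_succ', commutatorMap_apply, hδ, map_neg, hcoe]
  push_cast
  noncomm_ring

lemma sum_dividedPower_derivation {S : Subalgebra ℂ R} {δ : S →ₗ[ℂ] R}
    (hδ : ∀ a b : S, δ (a * b) = δ a * b + a * δ b) (u : S) (k : ℕ) :
    ∑ p ∈ antidiagonal (k + 1), dividedPower (u : R) p.1 * δ (dividedPower (-u) p.2) =
      -(((k + 1).factorial : ℂ)⁻¹ • (commutatorMap (u : R) ^ k) (δ u)) := by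
  have hδ_one : δ 1 = 0 := by simpa using hδ 1 1
  induction k with
  | zero =>
    have h := succ_smul_sum_dividedPower_derivation hδ u 0
    simpa [dividedPower_zero, hδ_one] using h
  | succ k ih =>
    have h := succ_smul_sum_dividedPower_derivation hδ u (k + 1)
    have hk : ((k + 1 : ℕ) + 1 : ℂ) ≠ 0 := Nat.cast_add_one_ne_zero (k + 1)
    rw [ih, sum_dividedPower_mul_neg, zero_mul, sub_zero] at h
    rw [← (smul_right_injective R hk).eq_iff]
    simp only [h, map_neg, map_smul, smul_neg, inv_factorial_succ_smul, pow_succ' _ k,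
      Module.End.mul_apply]

end DividedPowers

/-! ### Exponentials of power series -/

section Exponential

open PowerSeries

lemma order_le_order_smul {R : Type*} [Ring R] [Algebra ℂ R] (a : ℂ) (φ : R⟦X⟧) :
    φ.order ≤ (a • φ).order :=
  le_order _ _ fun i hi => by rw [coeff_smul, coeff_of_lt_order i hi, smul_zero]

lemma constantCoeff_neg_eq_zero {R : Type*} [Ring R] {u : R⟦X⟧} (hu : constantCoeff u = 0) :
    constantCoeff (-u) = 0 := by
  rw [map_neg, hu, neg_zero]

lemma le_order_mul_of_le_right {R : Type*} [Ring R] {m : ℕ∞} (φ : R⟦X⟧) {ψ : R⟦X⟧}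
    (h : m ≤ ψ.order) : m ≤ (φ * ψ).order :=
  (h.trans le_add_self).trans (le_order_mul φ ψ)

lemma le_order_dividedPower {R : Type*} [Ring R] [Algebra ℂ R] {u : R⟦X⟧}
    (hu : constantCoeff u = 0) (k : ℕ) : k ≤ (dividedPower u k).order :=
  (le_order_pow_of_constantCoeff_eq_zero k hu).trans (order_le_order_smul _ _)

lemma ringInverse_eq {R : Type*} [Ring R] {a b : R} (h : a * b = 1) (h' : b * a = 1) :
    Ring.inverse a = b :=
  Ring.inverse_unit (Units.mk a b h h')

variable {n : Type} [Fintype n] [DecidableEq n] {u v : MatSeries n}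

lemma expSeries_eq_formalSum (u : MatSeries n) : expSeries u = formalSum (dividedPower u) :=
  rfl

lemma constantCoeff_expSeries (u : MatSeries n) : constantCoeff (expSeries u) = 1 := by
  rw [← coeff_zero_eq_constantCoeff_apply]
  simp [expSeries]

lemma expSeries_conj (hu : constantCoeff u = 0) (v : MatSeries n) :
    expSeries u * (v * expSeries (-u)) =
      formalSum fun k => (k.factorial : ℂ)⁻¹ • (commutatorMap u ^ k) v := by
  have hneg := le_order_dividedPower (constantCoeff_neg_eq_zero hu)
  have hmul (k : ℕ) : k ≤ (v * dividedPower (-u) k).order :=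
    le_order_mul_of_le_right v (hneg k)
  rw [expSeries_eq_formalSum, expSeries_eq_formalSum, mul_formalSum v hneg,
    formalSum_mul_formalSum (le_order_dividedPower hu) hmul]
  simp only [sum_dividedPower_conj]

lemma expSeries_mul_expSeries_neg (hu : constantCoeff u = 0) :
    expSeries u * expSeries (-u) = 1 := by
  rw [expSeries_eq_formalSum, expSeries_eq_formalSum,
    formalSum_mul_formalSum (le_order_dividedPower hu)
      (le_order_dividedPower (constantCoeff_neg_eq_zero hu)),
    formalSum_eq_single_zero (sum_dividedPower_mul_neg u)]
  simp [dividedPower_zero]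

lemma expSeries_neg_mul_expSeries (hu : constantCoeff u = 0) :
    expSeries (-u) * expSeries u = 1 := by
  simpa only [neg_neg] using
    expSeries_mul_expSeries_neg (u := -u) (constantCoeff_neg_eq_zero hu)

lemma ringInverse_expSeries_neg (hu : constantCoeff u = 0) :
    Ring.inverse (expSeries (-u)) = expSeries u :=
  ringInverse_eq (expSeries_neg_mul_expSeries hu) (expSeries_mul_expSeries_neg hu)

lemma le_order_pow_succ_sub_pow_succ {R : Type*} [Ring R] {u v : R⟦X⟧} (hu : constantCoeff u = 0)
    (hv : constantCoeff v = 0) {m : ℕ} (h : m ≤ (u - v).order) (k : ℕ) :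
    (m + k : ℕ) ≤ (u ^ (k + 1) - v ^ (k + 1)).order := by
  induction k with
  | zero => simpa using h
  | succ k ih =>
    have hsplit : u ^ (k + 1 + 1) - v ^ (k + 1 + 1) =
        u ^ (k + 1) * (u - v) + (u ^ (k + 1) - v ^ (k + 1)) * v := by
      rw [pow_succ u (k + 1), pow_succ v (k + 1)]
      noncomm_ring
    have hv' : 1 ≤ v.order := one_le_order_iff_constCoeff_eq_zero.mpr hv
    rw [hsplit]
    refine (le_min ?_ ?_).trans (min_order_le_order_add _ _)
    · refine le_trans ?_ ((add_le_add (le_order_pow_of_constantCoeff_eq_zero (k + 1) hu) h).trans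
        (le_order_mul _ _))
      exact_mod_cast (by lia : m + (k + 1) ≤ k + 1 + m)
    · refine le_trans ?_ ((add_le_add ih hv').trans (le_order_mul _ _))
      exact_mod_cast (by lia : m + (k + 1) ≤ m + k + 1)

lemma expSeries_injOn : Set.InjOn (expSeries (n := n)) {u | constantCoeff u = 0} := by
  intro u hu v hv h
  refine sub_eq_zero.mp (eq_zero_of_order_raising fun m hm => ?_)
  have hcoeff := congrArg (coeff m) h
  rw [expSeries_eq_formalSum, expSeries_eq_formalSum,
    coeff_formalSum (le_order_dividedPower hu) (Nat.lt_succ_of_lt m.lt_succ_self),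
    coeff_formalSum (le_order_dividedPower hv) (Nat.lt_succ_of_lt m.lt_succ_self),
    Finset.sum_range_succ', Finset.sum_range_succ', Finset.sum_range_succ',
    Finset.sum_range_succ'] at hcoeff
  have hhigher (k : ℕ) :
      coeff m (dividedPower u (k + 1 + 1)) = coeff m (dividedPower v (k + 1 + 1)) := by
    have hk := le_order_pow_succ_sub_pow_succ hu hv hm (k + 1)
    rw [dividedPower, dividedPower, coeff_smul, coeff_smul, ← sub_eq_zero, ← smul_sub, ← map_sub,
      coeff_of_lt_order m (hk.trans_lt' (by exact_mod_cast Nat.lt_add_of_pos_right k.succ_pos)),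
      smul_zero]
  simp only [hhigher, dividedPower_zero, add_left_inj, add_right_inj] at hcoeff
  refine nat_le_order _ _ fun i hi => ?_
  rcases Nat.lt_succ_iff_lt_or_eq.mp hi with hi | rfl
  · exact coeff_of_lt_order i (hm.trans_lt' (by exact_mod_cast hi))
  · simpa [dividedPower, sub_eq_zero] using hcoeff

end Exponential

/-! ### Differentiation of power series -/

section SeriesDerivative

open PowerSeries

variable {n : Type} {F H : MatSeries n}

lemma coeff_pdSeries [Fintype n] [DecidableEq n] (μ : Fin 4) (F : MatSeries n) (m : ℕ) :
    coeff m (pdSeries μ F) = pdMat μ (coeff m F) :=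
  coeff_mk _ _

variable [Fintype n] [DecidableEq n]

lemma pdSeries_X_mul (F : MatSeries n) (μ : Fin 4) :
    pdSeries μ (X * F) = X * pdSeries μ F := by
  ext1 m
  cases m with
  | zero =>
    rw [coeff_pdSeries, coeff_zero_X_mul, coeff_zero_X_mul]
    exact pdMat_const μ 0
  | succ m => simp only [coeff_pdSeries, coeff_succ_X_mul]

lemma le_order_pdSeries {m : ℕ∞} (h : m ≤ F.order) (μ : Fin 4) : m ≤ (pdSeries μ F).order :=
  le_order _ _ fun i hi => by
    rw [coeff_pdSeries, coeff_of_lt_order i (hi.trans_le h)]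
    exact pdMat_const μ 0

variable (n) in
/-- Power series with smooth coefficients. -/
def smoothSeries : Subalgebra ℂ (MatSeries n) where
  carrier := {F | ∀ m, coeff m F ∈ smoothMat n}
  add_mem' hF hH m := by
    rw [map_add]
    exact add_mem (hF m) (hH m)
  mul_mem' hF hH m := by
    rw [coeff_mul]
    exact sum_mem fun p _ => mul_mem (hF p.1) (hH p.2)
  algebraMap_mem' a m := by
    rw [Algebra.algebraMap_eq_smul_one, coeff_smul, coeff_one]
    split_ifs
    · exact (smoothMat n).smul_mem (one_mem _) a
    · exact (smoothMat n).smul_mem (zero_mem _) a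

/-- The partial derivative `∂_μ` as a linear map on power series with smooth coefficients. -/
def pdSmooth (μ : Fin 4) : smoothSeries n →ₗ[ℂ] MatSeries n where
  toFun F := pdSeries μ F
  map_add' F H := by
    ext1 m
    simp only [coeff_pdSeries, map_add, Subalgebra.coe_add, pdMat_add (F.2 m) (H.2 m)]
  map_smul' a F := by
    ext1 m
    simp only [coeff_pdSeries, coeff_smul, Subalgebra.coe_smul, pdMat_smul a (F.2 m),
      RingHom.id_apply]

lemma pdSeries_mul (hF : F ∈ smoothSeries n) (hH : H ∈ smoothSeries n) (μ : Fin 4) :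
    pdSeries μ (F * H) = pdSeries μ F * H + F * pdSeries μ H := by
  ext1 m
  simp only [coeff_pdSeries, map_add, coeff_mul]
  rw [pdMat_sum (F := fun p : ℕ × ℕ => coeff p.1 F * coeff p.2 H) _
    (fun p => mul_mem (hF p.1) (hH p.2)), ← Finset.sum_add_distrib]
  exact Finset.sum_congr rfl fun p _ => pdMat_mul (hF p.1) (hH p.2) μ

lemma pdSeries_one (μ : Fin 4) : pdSeries μ (1 : MatSeries n) = 0 := by
  simpa using pdSeries_mul (one_mem (smoothSeries n)) (one_mem (smoothSeries n)) μ

lemma pdSeries_formalSum {a : ℕ → MatSeries n} (ha : ∀ k, a k ∈ smoothSeries n) (μ : Fin 4) :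
    pdSeries μ (formalSum a) = formalSum fun k => pdSeries μ (a k) := by
  ext1 m
  simp only [coeff_pdSeries, formalSum, coeff_mk]
  exact pdMat_sum _ (fun k => ha k m) μ

lemma dividedPower_mem_smoothSeries (hF : F ∈ smoothSeries n) (k : ℕ) :
    dividedPower F k ∈ smoothSeries n :=
  (smoothSeries n).smul_mem (pow_mem hF k) _

lemma expSeries_mul_pdSeries_expSeries_neg (h₀ : constantCoeff F = 0) (hF : F ∈ smoothSeries n)
    (μ : Fin 4) : expSeries F * pdSeries μ (expSeries (-F)) =
      formalSum fun k => ∑ p ∈ Finset.HasAntidiagonal.antidiagonal k,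
        dividedPower F p.1 * pdSeries μ (dividedPower (-F) p.2) := by
  have hpd (k : ℕ) : k ≤ (pdSeries μ (dividedPower (-F) k)).order :=
    le_order_pdSeries (le_order_dividedPower (constantCoeff_neg_eq_zero h₀) k) μ
  rw [expSeries_eq_formalSum, expSeries_eq_formalSum,
    pdSeries_formalSum (dividedPower_mem_smoothSeries (neg_mem hF)),
    formalSum_mul_formalSum (le_order_dividedPower h₀) hpd]

lemma sum_dividedPower_pdSeries (hF : F ∈ smoothSeries n) (μ : Fin 4) (k : ℕ) :
    ∑ p ∈ Finset.HasAntidiagonal.antidiagonal (k + 1),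
        dividedPower F p.1 * pdSeries μ (dividedPower (-F) p.2) =
      -(((k + 1).factorial : ℂ)⁻¹ • (commutatorMap F ^ k) (pdSeries μ F)) := by
  have hleibniz (a b : smoothSeries n) :
      pdSmooth μ (a * b) = pdSmooth μ a * b + a * pdSmooth μ b := pdSeries_mul a.2 b.2 μ
  exact sum_dividedPower_derivation hleibniz ⟨F, hF⟩ k

end SeriesDerivative

/-! ### Power series with coefficients in a given space -/

section Coefficientwise

open PowerSeries

variable {n : Type} [Fintype n] [DecidableEq n] {𝕜 : Type*} [Semiring 𝕜] [Module 𝕜 ℂ]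

/-- Power series whose coefficients lie in a given space of functions. -/
def seriesWithCoeffs (p : Submodule 𝕜 (MatFun n)) : Submodule 𝕜 (MatSeries n) where
  carrier := {F | ∀ m, coeff m F ∈ p}
  zero_mem' m := by
    rw [map_zero]
    exact zero_mem p
  add_mem' hF hH m := by
    rw [map_add]
    exact add_mem (hF m) (hH m)
  smul_mem' a _ hF m := p.smul_mem a (hF m)

/-- Power series of vector fields whose coefficients lie in a given space. -/
def fieldsWithCoeffs (p : Submodule 𝕜 (Fin 4 → MatFun n)) :
    Submodule 𝕜 (Fin 4 → MatSeries n) where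
  carrier := {v | ∀ m, (fun μ => coeff m (v μ)) ∈ p}
  zero_mem' _ := zero_mem p
  add_mem' hv hw m := add_mem (hv m) (hw m)
  smul_mem' a _ hv m := p.smul_mem a (hv m)

variable {p : Submodule 𝕜 (MatFun n)} {q : Submodule 𝕜 (Fin 4 → MatFun n)}

lemma X_mul_mem_seriesWithCoeffs {F : MatSeries n} (hF : F ∈ seriesWithCoeffs p) :
    X * F ∈ seriesWithCoeffs p := by
  rintro (_ | m)
  · rw [coeff_zero_X_mul]
    exact zero_mem p
  · rw [coeff_succ_X_mul]
    exact hF m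

lemma X_mul_mem_fieldsWithCoeffs {v : Fin 4 → MatSeries n} (hv : v ∈ fieldsWithCoeffs q) :
    (fun μ => X * v μ) ∈ fieldsWithCoeffs q := by
  rintro (_ | m)
  · simp only [coeff_zero_X_mul]
    exact zero_mem q
  · simp only [coeff_succ_X_mul]
    exact hv m

lemma formalSum_mem_fieldsWithCoeffs {a : ℕ → Fin 4 → MatSeries n}
    (ha : ∀ k, a k ∈ fieldsWithCoeffs q) :
    (fun μ => formalSum fun k => a k μ) ∈ fieldsWithCoeffs q := fun m => by
  simp only [formalSum, coeff_mk]
  convert sum_mem fun k (_ : k ∈ Finset.range (m + 1)) => ha k m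
  rw [Finset.sum_apply]

end Coefficientwise

section Spaces

open PowerSeries

variable {n : Type} [Fintype n] [DecidableEq n] (D : StringDistribution)

variable (n) in
/-- Power series whose coefficients decay rapidly. -/
abbrev rapidSeries : Submodule ℂ (MatSeries n) := seriesWithCoeffs (rapidMat n D)

variable (n) in
/-- Power series of vector fields whose coefficients decay rapidly. -/
abbrev rapidFields : Submodule ℂ (Fin 4 → MatSeries n) := fieldsWithCoeffs (rapidVec n D)

/-- The real space of `𝔤`-valued functions of rapid decay. -/
def lieScalars (𝔤 : Submodule ℝ (Matrix n n ℂ)) : Submodule ℝ (MatFun n) where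
  carrier := {s | IsLieScalar D 𝔤 s}
  zero_mem' := ⟨fun _ => 𝔤.zero_mem, (rapidMat n D).zero_mem⟩
  add_mem' hs ht := ⟨fun x => 𝔤.add_mem (hs.1 x) (ht.1 x), (rapidMat n D).add_mem hs.2 ht.2⟩
  smul_mem' r s hs := ⟨fun x => 𝔤.smul_mem r (hs.1 x),
    Complex.coe_smul r s ▸ (rapidMat n D).smul_mem (r : ℂ) hs.2⟩

/-- The real space of `𝔤`-valued vector fields of rapid decay. -/
def lieVectors (𝔤 : Submodule ℝ (Matrix n n ℂ)) : Submodule ℝ (Fin 4 → MatFun n) where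
  carrier := {v | IsLieVector D 𝔤 v}
  zero_mem' := ⟨fun _ _ => 𝔤.zero_mem, (rapidVec n D).zero_mem⟩
  add_mem' hv hw := ⟨fun μ x => 𝔤.add_mem (hv.1 μ x) (hw.1 μ x), (rapidVec n D).add_mem hv.2 hw.2⟩
  smul_mem' r v hv := ⟨fun μ x => 𝔤.smul_mem r (hv.1 μ x),
    Complex.coe_smul r v ▸ (rapidVec n D).smul_mem (r : ℂ) hv.2⟩

/-- The real space of gauge parameters. -/
abbrev gaugeParameters (𝔤 : Submodule ℝ (Matrix n n ℂ)) : Submodule ℝ (MatSeries n) :=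
  seriesWithCoeffs (lieScalars D 𝔤)

/-- The real space of potentials. -/
abbrev potentials (𝔤 : Submodule ℝ (Matrix n n ℂ)) : Submodule ℝ (Fin 4 → MatSeries n) :=
  fieldsWithCoeffs (lieVectors D 𝔤)

variable {D} {𝔤 : Submodule ℝ (Matrix n n ℂ)} {s t : MatSeries n} {v w : Fin 4 → MatSeries n}

lemma IsGaugeParameter.rapid (hs : IsGaugeParameter D 𝔤 s) : s ∈ rapidSeries n D :=
  fun m => (hs m).2

lemma IsPotential.rapid (hv : IsPotential D 𝔤 v) : v ∈ rapidFields n D :=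
  fun m => (hv m).2

lemma mem_smoothSeries_of_mem_rapidSeries (hs : s ∈ rapidSeries n D) : s ∈ smoothSeries n :=
  fun m => mem_smoothMat_of_mem_rapidMat (hs m)

lemma pdSeries_mem_rapidFields (hs : s ∈ rapidSeries n D) :
    (fun μ => pdSeries μ s) ∈ rapidFields n D := fun m => by
  simp only [coeff_pdSeries]
  exact pdMat_mem_rapidVec (hs m)

lemma mul_mem_rapidSeries (hs : s ∈ rapidSeries n D) (ht : t ∈ rapidSeries n D) :
    s * t ∈ rapidSeries n D := fun m => by
  rw [coeff_mul]
  exact sum_mem fun p _ => mul_mem_rapidMat (hs p.1) (ht p.2)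

lemma mul_mem_rapidFields (hs : s ∈ rapidSeries n D) (hv : v ∈ rapidFields n D) :
    (fun μ => s * v μ) ∈ rapidFields n D := fun m => by
  simp only [coeff_mul]
  convert sum_mem fun p (_ : p ∈ Finset.HasAntidiagonal.antidiagonal m) =>
    mul_mem_rapidVec (hs p.1) (hv p.2)
  rw [Finset.sum_apply]

lemma mul_mem_rapidFields_right (hs : s ∈ rapidSeries n D) (hv : v ∈ rapidFields n D) :
    (fun μ => v μ * s) ∈ rapidFields n D := fun m => by
  simp only [coeff_mul]
  convert sum_mem fun p (_ : p ∈ Finset.HasAntidiagonal.antidiagonal m) =>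
    mul_mem_rapidVec_right (hs p.2) (hv p.1)
  rw [Finset.sum_apply]

lemma IsGaugeParameter.grad (hs : IsGaugeParameter D 𝔤 s) :
    IsPotential D 𝔤 fun μ => pdSeries μ s := fun m => by
  simpa only [coeff_pdSeries] using (hs m).grad

lemma IsPotential.bracket (h𝔤 : IsBracketClosed 𝔤) (hs : IsGaugeParameter D 𝔤 s)
    (hv : IsPotential D 𝔤 v) : IsPotential D 𝔤 fun μ => commutatorMap (Complex.I • s) (v μ) :=
  fun m => by
    have hcoeff (μ : Fin 4) : coeff m (commutatorMap (Complex.I • s) (v μ)) =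
        ∑ p ∈ Finset.HasAntidiagonal.antidiagonal m,
          Complex.I • (coeff p.1 s * coeff p.2 (v μ) - coeff p.2 (v μ) * coeff p.1 s) := by
      rw [commutatorMap_apply, smul_mul_assoc, mul_smul_comm, ← smul_sub, coeff_smul, map_sub,
        coeff_mul, coeff_mul, ← Finset.Nat.sum_antidiagonal_swap
          (f := fun p => coeff p.1 (v μ) * coeff p.2 s), ← Finset.sum_sub_distrib, Finset.smul_sum]
      rfl
    simp only [hcoeff]
    change (fun μ => _) ∈ lieVectors D 𝔤
    convert (lieVectors D 𝔤).sum_mem fun p (_ : p ∈ Finset.HasAntidiagonal.antidiagonal m) =>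
      IsLieVector.bracket h𝔤 (hs p.1) (hv p.2)
    rw [Finset.sum_apply]

end Spaces

section StringSeries

open PowerSeries

variable {n : Type} [Fintype n] [DecidableEq n] {D : StringDistribution}
  {s : MatSeries n} {v w : Fin 4 → MatSeries n}

lemma coeff_stringSeries (v : Fin 4 → MatSeries n) (m : ℕ) :
    coeff m (stringSeries D v) = stringMat D fun μ => coeff m (v μ) :=
  coeff_mk _ _

lemma IsPotential.string {𝔤 : Submodule ℝ (Matrix n n ℂ)} (hv : IsPotential D 𝔤 v) :
    IsGaugeParameter D 𝔤 (stringSeries D v) := fun m => by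
  simpa only [coeff_stringSeries] using (hv m).string

lemma stringSeries_add (hv : v ∈ rapidFields n D) (hw : w ∈ rapidFields n D) :
    stringSeries D (v + w) = stringSeries D v + stringSeries D w := by
  ext1 m
  simp only [map_add, coeff_stringSeries]
  exact stringMat_add (hv m) (hw m)

lemma stringSeries_smul (a : ℂ) (hv : v ∈ rapidFields n D) :
    stringSeries D (a • v) = a • stringSeries D v := by
  ext1 m
  rw [coeff_smul]
  simp only [coeff_stringSeries]
  exact stringMat_smul a (hv m)

lemma stringSeries_X_mul (v : Fin 4 → MatSeries n) :
    stringSeries D (fun μ => X * v μ) = X * stringSeries D v := by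
  ext1 m
  cases m with
  | zero =>
    simp only [coeff_stringSeries, coeff_zero_X_mul]
    exact stringMat_zero
  | succ m => simp only [coeff_stringSeries, coeff_succ_X_mul]

lemma stringSeries_grad (hs : s ∈ rapidSeries n D) :
    stringSeries D (fun μ => pdSeries μ s) = -s := by
  ext1 m
  simp only [coeff_stringSeries, coeff_pdSeries, stringMat_grad (hs m), map_neg]

lemma pdSeries_stringSeries (hv : v ∈ rapidFields n D) (μ : Fin 4) :
    pdSeries μ (stringSeries D v) = stringSeries D fun ν => pdSeries μ (v ν) := by
  ext1 m
  simp only [coeff_stringSeries, coeff_pdSeries, pdMat_stringMat (hv m)]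

lemma le_order_stringSeries {m : ℕ∞} (h : ∀ μ, m ≤ (v μ).order) :
    m ≤ (stringSeries D v).order :=
  le_order _ _ fun i hi => by
    simp only [coeff_stringSeries, coeff_of_lt_order i (hi.trans_le (h _))]
    exact stringMat_zero

end StringSeries

/-! ### Gauge transformations -/

section AdExp

open PowerSeries

variable {n : Type} [Fintype n] [DecidableEq n] {D : StringDistribution}
  {𝔤 : Submodule ℝ (Matrix n n ℂ)} {s : MatSeries n}

/-- The power series `∑_k ad_{is}^k(v) / k! + ∑_k ad_{is}^k(w) / (k+1)!`, for `s` without term of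
order `g^0`. -/
def adExp (s v w : MatSeries n) : MatSeries n :=
  formalSum fun k => (k.factorial : ℂ)⁻¹ • (commutatorMap (Complex.I • s) ^ k) v +
    ((k + 1).factorial : ℂ)⁻¹ • (commutatorMap (Complex.I • s) ^ k) w

lemma formalSum_smul {R : Type*} [Ring R] [Algebra ℂ R] (c : ℂ) (a : ℕ → R⟦X⟧) :
    formalSum (fun k => c • a k) = c • formalSum a := by
  ext1 m
  simp only [formalSum, coeff_mk, coeff_smul, Finset.smul_sum]

lemma commutatorMap_pow_X_mul {R : Type*} [Ring R] [Algebra ℂ R] (u v : R⟦X⟧) (k : ℕ) :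
    (commutatorMap u ^ k) (X * v) = X * (commutatorMap u ^ k) v := by
  have hcomm : Commute (commutatorMap u) (LinearMap.mulLeft ℂ (X : R⟦X⟧)) := by
    refine LinearMap.ext fun w => ?_
    simp only [Module.End.mul_apply, LinearMap.mulLeft_apply, commutatorMap_apply, mul_sub,
      ← mul_assoc, (commute_X u).eq]
  exact LinearMap.congr_fun (hcomm.pow_left k).eq v

lemma divCoupling_X_mul (F : MatSeries n) : divCoupling (X * F) = F := by
  ext1 m
  rw [divCoupling, coeff_mk, coeff_succ_X_mul]

lemma constantCoeff_smul_X_mul (c : ℂ) (s : MatSeries n) : constantCoeff (c • (X * s)) = 0 := by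
  rw [← coeff_zero_eq_constantCoeff_apply, coeff_smul, coeff_zero_X_mul, smul_zero]

lemma pdSeries_smul (a : ℂ) (hs : s ∈ smoothSeries n) (μ : Fin 4) :
    pdSeries μ (a • s) = a • pdSeries μ s :=
  (pdSmooth μ).map_smul a ⟨s, hs⟩

lemma pdSeries_sub_one (hs : s ∈ smoothSeries n) (μ : Fin 4) :
    pdSeries μ (s - 1) = pdSeries μ s := by
  have hsub := map_sub (pdSmooth (n := n) μ) ⟨s, hs⟩ 1
  exact hsub.trans ((congrArg _ (pdSeries_one μ)).trans (sub_zero _))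

lemma smul_X_mul_mem_rapidSeries (a : ℂ) (hs : s ∈ rapidSeries n D) :
    a • (X * s) ∈ rapidSeries n D :=
  (rapidSeries n D).smul_mem a (X_mul_mem_seriesWithCoeffs hs)

lemma expSeries_mul_pdSeries_smul_X_mul (hs : s ∈ rapidSeries n D) (μ : Fin 4) :
    expSeries (Complex.I • (X * s)) * pdSeries μ (expSeries (-(Complex.I • (X * s)))) =
      X * (-Complex.I • formalSum fun k => ((k + 1).factorial : ℂ)⁻¹ •
        (commutatorMap (Complex.I • (X * s)) ^ k) (pdSeries μ s)) := by
  have hsmooth := mem_smoothSeries_of_mem_rapidSeries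
    (X_mul_mem_seriesWithCoeffs (p := rapidMat n D) hs)
  have hsmooth' := mem_smoothSeries_of_mem_rapidSeries (smul_X_mul_mem_rapidSeries Complex.I hs)
  rw [expSeries_mul_pdSeries_expSeries_neg (constantCoeff_smul_X_mul _ _) hsmooth',
    ← formalSum_smul]
  refine formalSum_X_mul ?_ fun k => ?_
  · simp [dividedPower_zero, pdSeries_one]
  · rw [sum_dividedPower_pdSeries hsmooth', pdSeries_smul _ hsmooth, pdSeries_X_mul, map_smul,
      commutatorMap_pow_X_mul, mul_smul_comm, mul_smul_comm, neg_smul, smul_comm]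

lemma gaugeTransform_expSeries_neg (hs : s ∈ rapidSeries n D) (A : Fin 4 → MatSeries n)
    (μ : Fin 4) : gaugeTransform (expSeries (-(Complex.I • (X * s)))) A μ =
      adExp (X * s) (A μ) (pdSeries μ s) := by
  have hzero := constantCoeff_smul_X_mul Complex.I s
  rw [gaugeTransform, ringInverse_expSeries_neg hzero, mul_assoc, expSeries_conj hzero,
    expSeries_mul_pdSeries_smul_X_mul hs, divCoupling_X_mul, smul_smul, mul_neg, Complex.I_mul_I,
    neg_neg, one_smul, adExp, formalSum_add]

lemma gaugeFunction_eq_expSeries_neg (l : MatSeries n) :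
    gaugeFunction l = expSeries (-(Complex.I • (X * -l))) := by
  rw [gaugeFunction, mul_neg, smul_neg, neg_neg]

lemma IsPotential.commutatorMap_pow (h𝔤 : IsBracketClosed 𝔤) (hs : IsGaugeParameter D 𝔤 s)
    {v : Fin 4 → MatSeries n} (hv : IsPotential D 𝔤 v) (k : ℕ) :
    IsPotential D 𝔤 fun μ => (commutatorMap (Complex.I • s) ^ k) (v μ) := by
  induction k with
  | zero => exact hv
  | succ k ih => simpa only [pow_succ', Module.End.mul_apply] using ih.bracket h𝔤 hs

lemma IsPotential.inv_natCast_smul {v : Fin 4 → MatSeries n} (hv : IsPotential D 𝔤 v) (k : ℕ) :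
    IsPotential D 𝔤 fun μ => (k : ℂ)⁻¹ • v μ := by
  have hreal : (k : ℂ)⁻¹ = ((k : ℝ)⁻¹ : ℝ) := by push_cast; rfl
  simp only [hreal, Complex.coe_smul]
  exact (potentials D 𝔤).smul_mem _ hv

lemma IsPotential.adExp (h𝔤 : IsBracketClosed 𝔤) (hs : IsGaugeParameter D 𝔤 s)
    {v w : Fin 4 → MatSeries n} (hv : IsPotential D 𝔤 v) (hw : IsPotential D 𝔤 w) :
    IsPotential D 𝔤 fun μ => adExp s (v μ) (w μ) :=
  formalSum_mem_fieldsWithCoeffs (q := lieVectors D 𝔤) fun k => (potentials D 𝔤).add_mem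
    ((hv.commutatorMap_pow h𝔤 hs k).inv_natCast_smul _)
    ((hw.commutatorMap_pow h𝔤 hs k).inv_natCast_smul _)

lemma IsPotential.gaugeTransform (h𝔤 : IsBracketClosed 𝔤) {l : MatSeries n}
    (hl : IsGaugeParameter D 𝔤 l) {A : Fin 4 → MatSeries n} (hA : IsPotential D 𝔤 A) :
    IsPotential D 𝔤 (gaugeTransform (gaugeFunction l) A) := by
  have hneg : IsGaugeParameter D 𝔤 (-l) := (gaugeParameters D 𝔤).neg_mem hl
  rw [gaugeFunction_eq_expSeries_neg,
    show _root_.gaugeTransform _ A = _ from funext (gaugeTransform_expSeries_neg hneg.rapid A)]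
  exact hA.adExp h𝔤 (X_mul_mem_seriesWithCoeffs (p := lieScalars D 𝔤) hneg) hneg.grad

end AdExp

/-! ### The action of gauge functions on connection forms -/

section ConnectionForms

open PowerSeries

variable {n : Type} [Fintype n] [DecidableEq n] {D : StringDistribution}
  {U W : (MatSeries n)ˣ} {B : Fin 4 → MatSeries n}

lemma mul_sub_one_mem_rapidSeries {F H : MatSeries n} (hF : F - 1 ∈ rapidSeries n D)
    (hH : H - 1 ∈ rapidSeries n D) : F * H - 1 ∈ rapidSeries n D := by
  have hsplit : F * H - 1 = (F - 1) * (H - 1) + ((F - 1) + (H - 1)) := by noncomm_ring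
  rw [hsplit]
  exact add_mem (mul_mem_rapidSeries hF hH) (add_mem hF hH)

variable (n D) in
/-- The group of invertible power series `U = 1 + O(g)` for which `U - 1` and `U⁻¹ - 1` decay
rapidly. -/
def unipotentUnits : Subgroup (MatSeries n)ˣ where
  carrier := {U | constantCoeff U.val = 1 ∧
    U.val - 1 ∈ rapidSeries n D ∧ U⁻¹.val - 1 ∈ rapidSeries n D}
  one_mem' := by simp
  mul_mem' := by
    rintro U W ⟨hU, hU₁, hU₂⟩ ⟨hW, hW₁, hW₂⟩
    refine ⟨?_, mul_sub_one_mem_rapidSeries hU₁ hW₁, ?_⟩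
    · rw [Units.val_mul, map_mul, hU, hW, one_mul]
    · rw [mul_inv_rev, Units.val_mul]
      exact mul_sub_one_mem_rapidSeries hW₂ hU₂
  inv_mem' := by
    rintro U ⟨hU, hU₁, hU₂⟩
    refine ⟨?_, hU₂, by rwa [inv_inv]⟩
    have h := congrArg constantCoeff U.mul_inv
    rwa [map_mul, hU, one_mul, map_one] at h

lemma mem_smoothSeries_of_mem_unipotentUnits (hU : U ∈ unipotentUnits n D) :
    U.val ∈ smoothSeries n := by
  have h := add_mem (mem_smoothSeries_of_mem_rapidSeries hU.2.1) (one_mem (smoothSeries n))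
  rwa [sub_add_cancel] at h

lemma expSeries_sub_one_mem_rapidSeries {u : MatSeries n} (hu : u ∈ rapidSeries n D) :
    expSeries u - 1 ∈ rapidSeries n D := fun m => by
  have hpow (k : ℕ) : u ^ (k + 1) ∈ rapidSeries n D := by
    induction k with
    | zero => rwa [zero_add, pow_one]
    | succ k ih => exact pow_succ u (k + 1) ▸ mul_mem_rapidSeries ih hu
  rw [map_sub, expSeries_eq_formalSum, formalSum, coeff_mk, Finset.sum_range_succ',
    dividedPower_zero, add_sub_cancel_right]
  exact sum_mem fun k _ => (rapidSeries n D).smul_mem _ (hpow k) m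

lemma exists_unipotentUnits_eq_expSeries {u : MatSeries n} (hzero : constantCoeff u = 0)
    (hu : u ∈ rapidSeries n D) : ∃ U ∈ unipotentUnits n D, U.val = expSeries u :=
  ⟨⟨_, _, expSeries_mul_expSeries_neg hzero, expSeries_neg_mul_expSeries hzero⟩,
    ⟨constantCoeff_expSeries u, expSeries_sub_one_mem_rapidSeries hu,
      expSeries_sub_one_mem_rapidSeries (neg_mem hu)⟩, rfl⟩

/-- The action `B ↦ U B U⁻¹ + i U ∂ U⁻¹` of gauge functions on connection forms `B = g A`. -/
def transformForm (U : (MatSeries n)ˣ) (B : Fin 4 → MatSeries n) : Fin 4 → MatSeries n :=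
  fun μ => U.val * B μ * U⁻¹.val + Complex.I • (U.val * pdSeries μ U⁻¹.val)

lemma transformForm_mul (hU : U ∈ unipotentUnits n D) (hW : W ∈ unipotentUnits n D)
    (B : Fin 4 → MatSeries n) :
    transformForm (U * W) B = transformForm U (transformForm W B) := by
  funext μ
  have hleibniz := pdSeries_mul (mem_smoothSeries_of_mem_unipotentUnits (inv_mem hW))
    (mem_smoothSeries_of_mem_unipotentUnits (inv_mem hU)) μ
  simp only [transformForm, mul_inv_rev, Units.val_mul, hleibniz, mul_add, add_mul, smul_add,
    mul_smul_comm, smul_mul_assoc, mul_assoc, Units.mul_inv_cancel_left, add_assoc]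

lemma X_mul_gaugeTransform (hU : U ∈ unipotentUnits n D) (A : Fin 4 → MatSeries n) (μ : Fin 4) :
    X * gaugeTransform U.val A μ = transformForm U⁻¹ (fun ν => X * A ν) μ := by
  have hzero : coeff 0 (U⁻¹.val * pdSeries μ U.val) = 0 := by
    rw [coeff_zero_eq_constantCoeff_apply, map_mul, ← coeff_zero_eq_constantCoeff_apply
      (pdSeries μ _), coeff_pdSeries, coeff_zero_eq_constantCoeff_apply, hU.1]
    exact mul_eq_zero_of_right _ (pdMat_const μ 1)
  have hdiv : X * divCoupling (U⁻¹.val * pdSeries μ U.val) =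
      U⁻¹.val * pdSeries μ U.val := by
    ext1 m
    cases m with
    | zero => rw [coeff_zero_X_mul, hzero]
    | succ m => rw [coeff_succ_X_mul, divCoupling, coeff_mk]
  rw [gaugeTransform, Ring.inverse_unit, transformForm, inv_inv, mul_add, mul_smul_comm, hdiv,
    ← mul_assoc, ← mul_assoc, ← (commute_X U⁻¹.val).eq, mul_assoc U⁻¹.val]

lemma transformForm_mem_rapidFields (hU : U ∈ unipotentUnits n D) (hB : B ∈ rapidFields n D) :
    transformForm U B ∈ rapidFields n D := by
  have hleft {v : Fin 4 → MatSeries n} (hv : v ∈ rapidFields n D) :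
      (fun μ => U.val * v μ) ∈ rapidFields n D := by
    simpa only [sub_mul, one_mul, Pi.add_def, sub_add_cancel] using
      add_mem (mul_mem_rapidFields hU.2.1 hv) hv
  have hright {v : Fin 4 → MatSeries n} (hv : v ∈ rapidFields n D) :
      (fun μ => v μ * U⁻¹.val) ∈ rapidFields n D := by
    simpa only [mul_sub, mul_one, Pi.add_def, sub_add_cancel] using
      add_mem (mul_mem_rapidFields_right hU.2.2 hv) hv
  have hgrad : (fun μ => pdSeries μ U⁻¹.val) ∈ rapidFields n D := by
    simp only [← pdSeries_sub_one (mem_smoothSeries_of_mem_unipotentUnits (inv_mem hU))]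
    exact pdSeries_mem_rapidFields hU.2.2
  exact add_mem (hright (hleft hB)) ((rapidFields n D).smul_mem _ (hleft hgrad))

lemma constantCoeff_transformForm (hU : U ∈ unipotentUnits n D) {μ : Fin 4}
    (hB : constantCoeff (B μ) = 0) : constantCoeff (transformForm U B μ) = 0 := by
  have hgrad : coeff 0 (pdSeries μ U⁻¹.val) = 0 := by
    rw [coeff_pdSeries, coeff_zero_eq_constantCoeff_apply, (inv_mem hU).1]
    exact pdMat_const μ 1
  rw [coeff_zero_eq_constantCoeff_apply] at hgrad
  rw [transformForm, ← mul_smul_comm, map_add, map_mul, map_mul, map_mul, hB, mul_zero, zero_mul,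
    zero_add, ← coeff_zero_eq_constantCoeff_apply (_ • _), coeff_smul,
    coeff_zero_eq_constantCoeff_apply, hgrad, smul_zero, mul_zero]

lemma transformForm_sub (hU : U ∈ unipotentUnits n D) (B : Fin 4 → MatSeries n) (μ : Fin 4) :
    transformForm U B μ - B μ = (U.val - 1) * B μ - transformForm U B μ * (U.val - 1) -
      Complex.I • pdSeries μ (U.val - 1) := by
  have hsmooth := mem_smoothSeries_of_mem_unipotentUnits hU
  have hleibniz := pdSeries_mul (mem_smoothSeries_of_mem_unipotentUnits (inv_mem hU)) hsmooth μ
  rw [Units.inv_mul, pdSeries_one] at hleibniz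
  have hinv : U.val * (pdSeries μ U⁻¹.val * U.val) = -pdSeries μ U.val := by
    rw [eq_neg_of_add_eq_zero_left hleibniz.symm, mul_neg, Units.mul_inv_cancel_left]
  have hright : transformForm U B μ * U.val = U.val * B μ - Complex.I • pdSeries μ U.val := by
    rw [transformForm, add_mul, smul_mul_assoc, mul_assoc U.val (pdSeries _ _), hinv,
      smul_neg, mul_assoc, Units.inv_mul, mul_one, sub_eq_add_neg]
  rw [pdSeries_sub_one hsmooth, sub_mul, one_mul, mul_sub, mul_one, hright]
  abel

lemma sub_one_eq_smul_stringSeries (hU : U ∈ unipotentUnits n D) (hB : B ∈ rapidFields n D)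
    (hs : stringSeries D B = 0) (hs' : stringSeries D (transformForm U B) = 0) :
    U.val - 1 = Complex.I • stringSeries D
      (fun μ => (U.val - 1) * B μ - transformForm U B μ * (U.val - 1)) := by
  have hB' := transformForm_mem_rapidFields hU hB
  have hgrad := pdSeries_mem_rapidFields hU.2.1
  have hcomm : (fun μ => (U.val - 1) * B μ - transformForm U B μ * (U.val - 1)) ∈
      rapidFields n D :=
    sub_mem (mul_mem_rapidFields hU.2.1 hB) (mul_mem_rapidFields_right hU.2.1 hB')
  have hsplit : transformForm U B + Complex.I • (fun μ => pdSeries μ (U.val - 1)) =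
      B + fun μ => (U.val - 1) * B μ - transformForm U B μ * (U.val - 1) := by
    funext μ
    have h := transformForm_sub hU B μ
    rw [sub_eq_iff_eq_add, sub_add_eq_add_sub, eq_sub_iff_add_eq] at h
    exact h.trans (add_comm _ _)
  have hstring := congrArg (stringSeries D) hsplit
  rw [stringSeries_add hB' (Submodule.smul_mem _ _ hgrad), stringSeries_smul _ hgrad,
    stringSeries_grad hU.2.1, hs', zero_add, stringSeries_add hB hcomm, hs, zero_add,
    smul_neg] at hstring
  rw [← hstring, smul_neg, smul_smul, Complex.I_mul_I, neg_smul, neg_neg, one_smul]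

lemma eq_one_of_stringSeries_transformForm_eq_zero (hU : U ∈ unipotentUnits n D)
    (hB : B ∈ rapidFields n D) (hB₀ : ∀ μ, constantCoeff (B μ) = 0)
    (hs : stringSeries D B = 0) (hs' : stringSeries D (transformForm U B) = 0) : U = 1 := by
  have hone_le {H : MatSeries n} (hH : constantCoeff H = 0) : 1 ≤ H.order :=
    one_le_order_iff_constCoeff_eq_zero.mpr hH
  have hraise (m : ℕ) (hm : m ≤ (U.val - 1).order) : (m + 1 : ℕ) ≤ (U.val - 1).order := by
    rw [sub_one_eq_smul_stringSeries hU hB hs hs', Nat.cast_succ]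
    refine (le_order_stringSeries fun μ => ?_).trans (order_le_order_smul _ _)
    rw [sub_eq_add_neg]
    refine (le_min ?_ ?_).trans (min_order_le_order_add _ _)
    · exact (add_le_add hm (hone_le (hB₀ μ))).trans (le_order_mul _ _)
    · rw [order_neg, add_comm]
      exact (add_le_add (hone_le (constantCoeff_transformForm hU (hB₀ μ))) hm).trans
        (le_order_mul _ _)
  exact Units.ext (sub_eq_zero.mp (eq_zero_of_order_raising hraise))

end ConnectionForms

/-! ### Dressing exponents -/

section SumSeries

open PowerSeries

variable {n : Type} [Fintype n] [DecidableEq n] {𝕜 : Type*} [Semiring 𝕜] [Module 𝕜 ℂ]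

lemma coeff_sumSeries (F : ℕ → MatSeries n) (m : ℕ) : coeff m (sumSeries F) =
    ∑ p ∈ Finset.HasAntidiagonal.antidiagonal m, coeff p.2 (F p.1) :=
  coeff_mk _ _

lemma sumSeries_eq_add (F : ℕ → MatSeries n) :
    sumSeries F = F 0 + X * sumSeries fun k => F (k + 1) := by
  ext1 m
  cases m with
  | zero => simp [coeff_sumSeries]
  | succ m => rw [map_add, coeff_succ_X_mul, coeff_sumSeries, coeff_sumSeries,
      Finset.Nat.sum_antidiagonal_succ]

lemma sumSeries_mem_seriesWithCoeffs {p : Submodule 𝕜 (MatFun n)} {F : ℕ → MatSeries n}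
    (hF : ∀ k, F k ∈ seriesWithCoeffs p) : sumSeries F ∈ seriesWithCoeffs p := fun m => by
  rw [coeff_sumSeries]
  exact sum_mem fun k _ => hF k.1 k.2

lemma sumSeries_mem_fieldsWithCoeffs {q : Submodule 𝕜 (Fin 4 → MatFun n)}
    {v : ℕ → Fin 4 → MatSeries n} (hv : ∀ k, v k ∈ fieldsWithCoeffs q) :
    (fun μ => sumSeries fun k => v k μ) ∈ fieldsWithCoeffs q := fun m => by
  simp only [coeff_sumSeries]
  convert sum_mem fun k (_ : k ∈ Finset.HasAntidiagonal.antidiagonal m) => hv k.1 k.2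
  rw [Finset.sum_apply]

end SumSeries

section DressingExponents

open PowerSeries

variable {n : Type} [Fintype n] [DecidableEq n] {D : StringDistribution}
  {𝔤 : Submodule ℝ (Matrix n n ℂ)} {A : Fin 4 → MatSeries n} {γ γ' : ScalarField n}

lemma adField_eq_commutatorMap (s : ScalarField n) (v : VectorField n) (A : Fin 4 → MatSeries n) :
    adField s v A = fun μ => commutatorMap (Complex.I • s A) (v A μ) := by
  funext μ
  rw [adField, commutatorMap_apply, smul_mul_assoc, mul_smul_comm, smul_sub]

lemma IsPotential.adChain (h𝔤 : IsBracketClosed 𝔤) {l : List (ScalarField n)} {v : VectorField n}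
    (hv : IsPotential D 𝔤 (v A)) (hl : ∀ s ∈ l, IsGaugeParameter D 𝔤 (s A)) :
    IsPotential D 𝔤 (adChain l v A) := by
  induction l with
  | nil => exact hv
  | cons s l ih =>
    have htail := ih fun t ht => hl t (List.mem_cons_of_mem s ht)
    change IsPotential D 𝔤 (adField s (_root_.adChain l v) A)
    rw [adField_eq_commutatorMap]
    exact htail.bracket h𝔤 (hl s List.mem_cons_self)

lemma InS.isGaugeParameter (h𝔤 : IsBracketClosed 𝔤) {s : ScalarField n} (hs : InS D s)
    (hA : IsPotential D 𝔤 A) : IsGaugeParameter D 𝔤 (s A) := by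
  induction hs with
  | zero => exact (gaugeParameters D 𝔤).zero_mem
  | add s t _ _ hs ht => exact (gaugeParameters D 𝔤).add_mem hs ht
  | smul r s _ hs => exact (gaugeParameters D 𝔤).smul_mem r hs
  | string_A l _ hl => exact (IsPotential.adChain h𝔤 (v := potentialField) hA hl).string
  | string_grad l s₀ _ _ _ hl hs₀ =>
    exact (IsPotential.adChain h𝔤 (v := gradField s₀) hs₀.grad hl).string

lemma IsDressingExponent.exists_parameter (hγ : IsDressingExponent D 𝔤 γ) (h𝔤 : IsBracketClosed 𝔤)
    (hA : IsPotential D 𝔤 A) : ∃ G, IsGaugeParameter D 𝔤 G ∧ γ A = X * G := by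
  obtain ⟨a, ha, ha₀, hsum⟩ := hγ.1
  refine ⟨sumSeries fun k => a (k + 1) A, sumSeries_mem_seriesWithCoeffs (p := lieScalars D 𝔤)
    fun k => (ha (k + 1)).isGaugeParameter h𝔤 hA, ?_⟩
  rw [hsum A hA, sumSeries_eq_add, ha₀, Pi.zero_apply, zero_add]

lemma IsGaugeParameter.exists_unit {G : MatSeries n} (hG : IsGaugeParameter D 𝔤 G) :
    ∃ U ∈ unipotentUnits n D, U.val = expSeries (Complex.I • (X * G)) :=
  exists_unipotentUnits_eq_expSeries (constantCoeff_smul_X_mul _ _)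
    (smul_X_mul_mem_rapidSeries _ hG.rapid)

lemma IsDressingExponent.exists_unit (hγ : IsDressingExponent D 𝔤 γ) (h𝔤 : IsBracketClosed 𝔤)
    (hA : IsPotential D 𝔤 A) : ∃ U ∈ unipotentUnits n D, U.val = dressingFactor γ A ∧
      stringSeries D (transformForm U fun μ => X * A μ) = 0 := by
  obtain ⟨G, hG, hγA⟩ := hγ.exists_parameter h𝔤 hA
  obtain ⟨U, hU, hUG⟩ := hG.exists_unit
  have hval : U.val = dressingFactor γ A := by rw [hUG, dressingFactor, hγA]
  refine ⟨U, hU, hval, ?_⟩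
  simpa only [← hval, Ring.inverse_unit] using! hγ.2 A hA

lemma eq_of_stringSeries_transformForm_eq_zero {U U' : (MatSeries n)ˣ}
    (hU : U ∈ unipotentUnits n D) (hU' : U' ∈ unipotentUnits n D) (hA : IsPotential D 𝔤 A)
    (hs : stringSeries D (transformForm U fun μ => X * A μ) = 0)
    (hs' : stringSeries D (transformForm U' fun μ => X * A μ) = 0) : U' = U := by
  have hquot : U' * U⁻¹ ∈ unipotentUnits n D := mul_mem hU' (inv_mem hU)
  refine mul_inv_eq_one.mp (eq_one_of_stringSeries_transformForm_eq_zero hquot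
    (transformForm_mem_rapidFields hU (X_mul_mem_fieldsWithCoeffs hA.rapid))
    (fun μ => constantCoeff_transformForm hU ?_) hs ?_)
  · rw [map_mul, constantCoeff_X, zero_mul]
  · rwa [← transformForm_mul hquot hU, inv_mul_cancel_right]

lemma IsDressingExponent.unique (hγ : IsDressingExponent D 𝔤 γ) (hγ' : IsDressingExponent D 𝔤 γ')
    (h𝔤 : IsBracketClosed 𝔤) (hA : IsPotential D 𝔤 A) : γ' A = γ A := by
  obtain ⟨U, hU, hval, hs⟩ := hγ.exists_unit h𝔤 hA
  obtain ⟨U', hU', hval', hs'⟩ := hγ'.exists_unit h𝔤 hA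
  have hexp : expSeries (Complex.I • γ' A) = expSeries (Complex.I • γ A) := by
    rw [← dressingFactor, ← dressingFactor, ← hval, ← hval',
      eq_of_stringSeries_transformForm_eq_zero hU hU' hA hs hs']
  have hzero {γ : ScalarField n} (hγ : IsDressingExponent D 𝔤 γ) :
      constantCoeff (Complex.I • γ A) = 0 := by
    obtain ⟨G, -, hγA⟩ := hγ.exists_parameter h𝔤 hA
    rw [hγA, constantCoeff_smul_X_mul]
  exact smul_right_injective _ Complex.I_ne_zero (expSeries_injOn (hzero hγ') (hzero hγ) hexp)

lemma X_mul_dressedPotential {U : (MatSeries n)ˣ} (hU : U ∈ unipotentUnits n D)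
    (hval : U.val = dressingFactor γ A) :
    (fun μ => X * dressedPotential γ A μ) = transformForm U fun μ => X * A μ := by
  funext μ
  rw [dressedPotential, ← hval, Ring.inverse_unit, X_mul_gaugeTransform (inv_mem hU), inv_inv]

lemma IsDressingExponent.gauge_covariant (hγ : IsDressingExponent D 𝔤 γ) (h𝔤 : IsBracketClosed 𝔤)
    {l : MatSeries n} (hl : IsGaugeParameter D 𝔤 l) (hA : IsPotential D 𝔤 A) :
    dressingFactor γ (gaugeTransform (gaugeFunction l) A) =
        dressingFactor γ A * gaugeFunction l ∧
      dressedPotential γ (gaugeTransform (gaugeFunction l) A) = dressedPotential γ A := by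
  obtain ⟨T, hT, hval_T⟩ := hl.exists_unit
  obtain ⟨U, hU, hval, hs⟩ := hγ.exists_unit h𝔤 hA
  have hA' := hA.gaugeTransform h𝔤 hl
  obtain ⟨U', hU', hval', hs'⟩ := hγ.exists_unit h𝔤 hA'
  rw [← gaugeFunction] at hval_T
  rw [← hval_T] at hval' hs' hA' ⊢
  have hcov : transformForm (U * T) (fun μ => X * gaugeTransform T.val A μ) =
      transformForm U fun μ => X * A μ := by
    simp only [X_mul_gaugeTransform hT]
    rw [← transformForm_mul (mul_mem hU hT) (inv_mem hT), mul_inv_cancel_right]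
  have hU'_eq : U' = U * T :=
    eq_of_stringSeries_transformForm_eq_zero (mul_mem hU hT) hU' hA' (hcov ▸ hs) hs'
  have hdress := (X_mul_dressedPotential hU' hval').trans
    (hU'_eq ▸ hcov.trans (X_mul_dressedPotential hU hval).symm)
  refine ⟨?_, funext fun μ => X_mul_injective (congrFun hdress μ)⟩
  rw [← hval', hU'_eq, Units.val_mul, hval]

end DressingExponents

/-! ### Series of fields -/

section CoefficientSequences

variable {M : Type*} [AddCommGroup M] [Module ℝ M]

/-- Multiplication by `g` of the formal power series `∑_k g^k x_k` with coefficients in `M`, which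
is represented by the sequence `x`. -/
def delay : (ℕ → M) →ₗ[ℝ] ℕ → M where
  toFun x
    | 0 => 0
    | m + 1 => x m
  map_add' x y := by
    funext m
    cases m with
    | zero => exact (add_zero 0).symm
    | succ m => rfl
  map_smul' r x := by
    funext m
    cases m with
    | zero => exact (smul_zero r).symm
    | succ m => rfl

/-- The product of formal power series with coefficients in `M` that is induced by a bilinear map
of `M`. -/
def convolution (B : M →ₗ[ℝ] M →ₗ[ℝ] M) (a : ℕ → M) : Module.End ℝ (ℕ → M) where
  toFun x m := ∑ p ∈ Finset.HasAntidiagonal.antidiagonal m, B (a p.1) (x p.2)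
  map_add' x y := by
    funext m
    simp only [Pi.add_apply, map_add, Finset.sum_add_distrib]
  map_smul' r x := by
    funext m
    simp only [Pi.smul_apply, map_smul, Finset.smul_sum, RingHom.id_apply]

/-- The series `∑_k c_k T^k x` in an operator `T` that raises the order in `g`, so that only
`k ≤ m` contributes to the order `g^m`. -/
def operatorSeries (c : ℕ → ℝ) (T : Module.End ℝ (ℕ → M)) (x : ℕ → M) : ℕ → M :=
  fun m => ∑ k ∈ Finset.range (m + 1), c k • (T ^ k) x m

variable {B : M →ₗ[ℝ] M →ₗ[ℝ] M} {T : Module.End ℝ (ℕ → M)} {a a' x x' : ℕ → M} {m : ℕ}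

lemma delay_zero (x : ℕ → M) : delay x 0 = 0 := rfl

lemma delay_succ (x : ℕ → M) (m : ℕ) : delay x (m + 1) = x m := rfl

lemma convolution_apply (B : M →ₗ[ℝ] M →ₗ[ℝ] M) (a x : ℕ → M) (m : ℕ) : convolution B a x m =
    ∑ p ∈ Finset.HasAntidiagonal.antidiagonal m, B (a p.1) (x p.2) :=
  rfl

lemma convolution_delay_zero : convolution B (delay a) x 0 = 0 := by
  rw [convolution_apply, Finset.Nat.antidiagonal_zero, Finset.sum_singleton, delay_zero,
    LinearMap.map_zero₂]

lemma convolution_delay_succ : convolution B (delay a) x (m + 1) = convolution B a x m := by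
  simp only [convolution_apply, Finset.Nat.sum_antidiagonal_succ, delay_zero, delay_succ,
    LinearMap.map_zero₂, zero_add]

lemma convolution_delay_delay :
    convolution B (delay a) (delay x) = delay (convolution B (delay a) x) := by
  funext m
  cases m with
  | zero => exact convolution_delay_zero
  | succ m => simp only [convolution_apply, Finset.Nat.sum_antidiagonal_succ', delay_zero,
      delay_succ, map_zero, zero_add]

lemma convolution_congr (ha : ∀ k < m + 1, a k = a' k) (hx : ∀ k < m + 1, x k = x' k) :
    convolution B a x m = convolution B a' x' m := by
  simp only [convolution_apply]
  refine Finset.sum_congr rfl fun p hp => ?_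
  have := Finset.HasAntidiagonal.mem_antidiagonal.mp hp
  rw [ha _ (by omega), hx _ (by omega)]

lemma convolution_delay_congr (ha : ∀ k < m, a k = a' k) (hx : ∀ k < m, x k = x' k) :
    ∀ k < m + 1, convolution B (delay a) x k = convolution B (delay a') x' k
  | 0, _ => convolution_delay_zero.trans convolution_delay_zero.symm
  | k + 1, hk => by
    rw [convolution_delay_succ, convolution_delay_succ]
    exact convolution_congr (fun j hj => ha j (by omega)) fun j hj => hx j (by omega)

lemma convolution_delay_pow_congr (ha : ∀ k < m, a k = a' k) (hx : ∀ k < m + 1, x k = x' k)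
    (j : ℕ) : ∀ k < m + 1,
      (convolution B (delay a) ^ j) x k = (convolution B (delay a') ^ j) x' k := by
  induction j with
  | zero => exact hx
  | succ j ih =>
    simp only [pow_succ', Module.End.mul_apply]
    exact convolution_delay_congr ha fun k hk => ih k (by omega)

lemma convolution_delay_pow_eq_zero (a x : ℕ → M) :
    ∀ {k m : ℕ}, m < k → (convolution B (delay a) ^ k) x m = 0
  | k + 1, 0, _ => by rw [pow_succ', Module.End.mul_apply, convolution_delay_zero]
  | k + 1, m + 1, hm => by
    rw [pow_succ', Module.End.mul_apply, convolution_delay_succ, convolution_apply]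
    refine Finset.sum_eq_zero fun p hp => ?_
    have := Finset.HasAntidiagonal.mem_antidiagonal.mp hp
    rw [convolution_delay_pow_eq_zero a x (by omega), map_zero]

lemma operatorSeries_convolution_congr (c : ℕ → ℝ) (ha : ∀ k < m, a k = a' k)
    (hx : ∀ k < m + 1, x k = x' k) :
    operatorSeries c (convolution B (delay a)) x m =
      operatorSeries c (convolution B (delay a')) x' m :=
  Finset.sum_congr rfl fun j _ => by
    rw [convolution_delay_pow_congr ha hx j m (Nat.lt_succ_self m)]

lemma operatorSeries_delay (c : ℕ → ℝ) (hT : ∀ k m, m < k → (T ^ k) x m = 0)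
    (hdelay : ∀ y, T (delay y) = delay (T y)) :
    operatorSeries c T (delay x) = delay (operatorSeries c T x) := by
  have hpow (k : ℕ) : (T ^ k) (delay x) = delay ((T ^ k) x) := by
    induction k with
    | zero => rfl
    | succ k ih => rw [pow_succ', Module.End.mul_apply, Module.End.mul_apply, ih, hdelay]
  funext m
  simp only [operatorSeries, hpow]
  cases m with
  | zero => exact Finset.sum_eq_zero fun k _ => smul_zero (c k)
  | succ m =>
    simp only [delay_succ, operatorSeries]
    rw [Finset.sum_range_succ, hT _ _ (Nat.lt_succ_self m), smul_zero, add_zero]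

lemma operatorSeries_eq_add (c : ℕ → ℝ) (hT : ∀ k m, m < k → (T ^ k) x m = 0) :
    operatorSeries c T x = c 0 • x + operatorSeries (fun k => c (k + 1)) T (T x) := by
  funext m
  rw [operatorSeries, Finset.sum_range_succ', add_comm, Pi.add_apply, operatorSeries,
    Finset.sum_range_succ, ← Module.End.mul_apply, ← pow_succ, hT _ _ (Nat.lt_succ_self m),
    smul_zero, add_zero]
  rfl

lemma operatorSeries_comp_left (c : ℕ → ℝ) (φ : M →ₗ[ℝ] M)
    (hφ : ∀ y, (T fun k => φ (y k)) = fun k => φ (T y k)) :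
    (operatorSeries c T fun k => φ (x k)) = fun k => φ (operatorSeries c T x k) := by
  have hpow (j : ℕ) : ((T ^ j) fun k => φ (x k)) = fun k => φ ((T ^ j) x k) := by
    induction j with
    | zero => rfl
    | succ j ih => rw [pow_succ', Module.End.mul_apply, Module.End.mul_apply, ih, hφ]
  funext m
  simp only [operatorSeries, hpow, map_sum, map_smul]

lemma exists_fixedPoint_of_causal {M : Type*} [Zero M] {F : (ℕ → M) → ℕ → M}
    (hF : ∀ {m : ℕ} {a a' : ℕ → M}, (∀ k < m, a k = a' k) → F a m = F a' m) :
    ∃ a, F a = a := by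
  let step (m : ℕ) (prev : (k : ℕ) → k < m → M) : M :=
    F (fun k => if h : k < m then prev k h else 0) m
  let a : ℕ → M := Nat.strongRec step
  refine ⟨a, funext fun m => ?_⟩
  have ha : a m = step m fun k _ => a k := Nat.strongRec_eq ..
  rw [ha]
  exact hF fun k hk => by simp only [dif_pos hk]

lemma eq_delay_of_apply_zero (h : x 0 = 0) : x = delay fun m => x (m + 1) := by
  funext m
  cases m with
  | zero => exact h
  | succ m => rfl

/-- The coefficients of the exponential series. -/
def expCoeff (k : ℕ) : ℝ := (k.factorial : ℝ)⁻¹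

lemma expCoeff_zero : expCoeff 0 = 1 := by rw [expCoeff, Nat.factorial_zero, Nat.cast_one, inv_one]

lemma expCoeff_one : expCoeff (0 + 1) = 1 := by
  rw [expCoeff, zero_add, Nat.factorial_one, Nat.cast_one, inv_one]

lemma operatorSeries_convolution_apply_zero (c : ℕ → ℝ) :
    operatorSeries c (convolution B (delay a)) (convolution B (delay a) x) 0 = 0 := by
  rw [operatorSeries, zero_add, Finset.sum_range_one, pow_zero, Module.End.one_apply,
    convolution_delay_zero, smul_zero]

lemma operatorSeries_convolution_eq_add (c : ℕ → ℝ) (a x : ℕ → M) :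
    operatorSeries c (convolution B (delay a)) x = c 0 • x +
      operatorSeries (fun k => c (k + 1)) (convolution B (delay a)) (convolution B (delay a) x) :=
  operatorSeries_eq_add c fun _ _ => convolution_delay_pow_eq_zero a x

lemma exists_eq_operatorSeries_add (B : M →ₗ[ℝ] M →ₗ[ℝ] M) (L : M →ₗ[ℝ] M) (x : ℕ → M) :
    ∃ e, (∃ e', e = x + delay e') ∧
      operatorSeries expCoeff (convolution B (delay e)) x +
        operatorSeries (fun k => expCoeff (k + 1)) (convolution B (delay e)) (fun k => L (e k)) =
      e + fun k => L (e k) := by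
  have hcausal {m : ℕ} {e e' : ℕ → M} (he : ∀ k < m, e k = e' k) :=
    congrArg₂ (· + ·)
      (operatorSeries_convolution_congr (B := B) expCoeff he fun k _ => Eq.refl (x k))
      (operatorSeries_convolution_congr (B := B) (fun k => expCoeff (k + 1 + 1)) he
        (convolution_delay_congr (B := B) he fun k hk => congrArg L (he k hk)))
  obtain ⟨e, he⟩ := exists_fixedPoint_of_causal (F := fun e =>
    operatorSeries expCoeff (convolution B (delay e)) x +
      operatorSeries (fun k => expCoeff (k + 1 + 1)) (convolution B (delay e))
        (convolution B (delay e) fun k => L (e k))) hcausal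
  refine ⟨e, ⟨fun m => (e - x) (m + 1), ?_⟩, ?_⟩
  · rw [← eq_delay_of_apply_zero, add_sub_cancel]
    nth_rw 1 [← he]
    rw [operatorSeries_convolution_eq_add expCoeff]
    rw [expCoeff_zero, one_smul, add_assoc, add_sub_cancel_left, Pi.add_apply,
      operatorSeries_convolution_apply_zero, operatorSeries_convolution_apply_zero, add_zero]
  · rw [operatorSeries_convolution_eq_add (fun k => expCoeff (k + 1))]
    rw [expCoeff_one, one_smul, add_left_comm, he, add_comm]

lemma convolution_single_zero {u : M} (hu : ∀ b, B b u = b) (a : ℕ → M) :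
    convolution B a (Pi.single 0 u) = a := by
  funext m
  rw [convolution_apply, Finset.sum_eq_single (m, 0)]
  · rw [Pi.single_eq_same, hu]
  · rintro ⟨i, j⟩ hij hne
    have hj : j ≠ 0 := by
      rintro rfl
      exact hne (by simpa using hij)
    rw [Pi.single_eq_of_ne hj, map_zero]
  · exact fun hm => absurd (by simp) hm

lemma exists_operatorSeries_eq (B : M →ₗ[ℝ] M →ₗ[ℝ] M) {u : M} (hu : ∀ b, B b u = b)
    (e : ℕ → M) : ∃ a, operatorSeries expCoeff (convolution B (delay a)) (Pi.single 0 u) =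
      Pi.single 0 u + delay e := by
  have hcausal {m : ℕ} {a a' : ℕ → M} (ha : ∀ k < m, a k = a' k) :=
    congrArg (e m - ·) (operatorSeries_convolution_congr (B := B) (fun k => expCoeff (k + 1 + 1)) ha
      (convolution_delay_congr (B := B) ha ha))
  obtain ⟨a, ha⟩ := exists_fixedPoint_of_causal (F := fun a =>
    e - operatorSeries (fun k => expCoeff (k + 1 + 1)) (convolution B (delay a))
      (convolution B (delay a) a)) hcausal
  refine ⟨a, ?_⟩
  have he : operatorSeries (fun k => expCoeff (k + 1)) (convolution B (delay a)) a = e := by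
    rw [operatorSeries_convolution_eq_add]
    nth_rw 1 [← ha]
    rw [expCoeff_one, one_smul, sub_add_cancel]
  rw [operatorSeries_convolution_eq_add, convolution_single_zero hu, operatorSeries_delay _
    (fun _ _ => convolution_delay_pow_eq_zero a a) fun _ => convolution_delay_delay, he,
    expCoeff_zero, one_smul]

end CoefficientSequences

/-! ### Polynomial functionals -/

section PolynomialMaps

variable {P : Type*} [AddCommGroup P] [Module ℝ P]

/-- The polynomial curves `ε ↦ ∑_k ε^k v_k` in a real vector space. -/
def polynomialCurves (P : Type*) [AddCommGroup P] [Module ℝ P] : Submodule ℝ (ℝ → P) :=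
  Submodule.span ℝ (Set.range fun (p : ℕ × P) ε => ε ^ p.1 • p.2)

lemma monomial_mem_polynomialCurves (k : ℕ) (v : P) :
    (fun ε => ε ^ k • v) ∈ polynomialCurves P :=
  Submodule.subset_span ⟨(k, v), rfl⟩

lemma const_mem_polynomialCurves (v : P) : (fun _ => v) ∈ polynomialCurves P := by
  simpa only [pow_zero, one_smul] using monomial_mem_polynomialCurves 0 v

lemma apply_polynomialCurves_mem {E : Type*} [AddCommGroup E] [Module ℝ E] (φ : ℝ → P →ₗ[ℝ] E)
    (q : Submodule ℝ (ℝ → E)) (hφ : ∀ k v, (fun ε => φ ε (ε ^ k • v)) ∈ q) {c : ℝ → P}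
    (hc : c ∈ polynomialCurves P) : (fun ε => φ ε (c ε)) ∈ q := by
  let Φ : (ℝ → P) →ₗ[ℝ] ℝ → E := LinearMap.pi fun ε => φ ε ∘ₗ LinearMap.proj ε
  have hle : polynomialCurves P ≤ q.comap Φ :=
    Submodule.span_le.mpr (Set.range_subset_iff.mpr fun p => hφ p.1 p.2)
  exact hle hc

lemma smul_mem_polynomialCurves {c : ℝ → P} (hc : c ∈ polynomialCurves P) :
    (fun ε => ε • c ε) ∈ polynomialCurves P := by
  refine apply_polynomialCurves_mem (fun ε => ε • LinearMap.id) _ (fun k v => ?_) hc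
  simpa only [LinearMap.smul_apply, LinearMap.id_apply, smul_smul, ← pow_succ'] using
    monomial_mem_polynomialCurves (k + 1) v

lemma map_mem_polynomialCurves (L : P →ₗ[ℝ] P) {c : ℝ → P} (hc : c ∈ polynomialCurves P) :
    (fun ε => L (c ε)) ∈ polynomialCurves P := by
  refine apply_polynomialCurves_mem (fun _ => L) _ (fun k v => ?_) hc
  simpa only [map_smul] using monomial_mem_polynomialCurves k (L v)

lemma bilin_mem_polynomialCurves (B : P →ₗ[ℝ] P →ₗ[ℝ] P) {c d : ℝ → P}
    (hc : c ∈ polynomialCurves P) (hd : d ∈ polynomialCurves P) :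
    (fun ε => B (c ε) (d ε)) ∈ polynomialCurves P := by
  refine apply_polynomialCurves_mem (fun ε => B.flip (d ε)) _ (fun k v => ?_) hc
  refine apply_polynomialCurves_mem (fun ε => B (ε ^ k • v)) _ (fun l w => ?_) hd
  simpa only [map_smul, LinearMap.smul_apply, smul_smul, ← pow_add] using
    monomial_mem_polynomialCurves (l + k) (B v w)

lemma continuous_apply_polynomialCurves {E : Type*} [NormedAddCommGroup E] [NormedSpace ℝ E]
    (φ : P →ₗ[ℝ] E) {c : ℝ → P} (hc : c ∈ polynomialCurves P) : Continuous fun ε => φ (c ε) := by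
  refine apply_polynomialCurves_mem (fun _ => φ) (continuousSubmodule ℝ ℝ E) (fun k v => ?_) hc
  simpa only [map_smul] using! (continuous_pow k).smul (continuous_const (y := φ v))

/-- The polynomial curve `c` has the tangent vector `w` at `0`. The difference quotient `d` of `c`
is again polynomial, and `w = d 0`. -/
def HasTangent (c : ℝ → P) (w : P) : Prop :=
  ∃ d ∈ polynomialCurves P, d 0 = w ∧ ∀ ε, c ε = c 0 + ε • d ε

namespace HasTangent

variable {c c' : ℝ → P} {w w' : P}

lemma mem_polynomialCurves (hc : HasTangent c w) : c ∈ polynomialCurves P := by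
  obtain ⟨d, hd, -, hcd⟩ := hc
  rw [funext hcd]
  exact add_mem (const_mem_polynomialCurves (c 0)) (smul_mem_polynomialCurves hd)

lemma add (hc : HasTangent c w) (hc' : HasTangent c' w') :
    HasTangent (fun ε => c ε + c' ε) (w + w') := by
  obtain ⟨d, hd, rfl, hcd⟩ := hc
  obtain ⟨d', hd', rfl, hcd'⟩ := hc'
  refine ⟨d + d', add_mem hd hd', rfl, fun ε => ?_⟩
  simp only [hcd ε, hcd' ε, Pi.add_apply, smul_add, add_add_add_comm]

lemma smul (r : ℝ) (hc : HasTangent c w) : HasTangent (fun ε => r • c ε) (r • w) := by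
  obtain ⟨d, hd, rfl, hcd⟩ := hc
  refine ⟨r • d, Submodule.smul_mem _ r hd, rfl, fun ε => ?_⟩
  simp only [hcd ε, Pi.smul_apply, smul_add, smul_comm r ε]

lemma map (L : P →ₗ[ℝ] P) (hc : HasTangent c w) : HasTangent (fun ε => L (c ε)) (L w) := by
  obtain ⟨d, hd, rfl, hcd⟩ := hc
  refine ⟨fun ε => L (d ε), map_mem_polynomialCurves L hd, rfl, fun ε => ?_⟩
  simp only [hcd ε, map_add, map_smul]

lemma bilin (B : P →ₗ[ℝ] P →ₗ[ℝ] P) (hc : HasTangent c w) (hc' : HasTangent c' w') :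
    HasTangent (fun ε => B (c ε) (c' ε)) (B w (c' 0) + B (c 0) w') := by
  have hpoly := hc.mem_polynomialCurves
  obtain ⟨d, hd, rfl, hcd⟩ := hc
  obtain ⟨d', hd', rfl, hcd'⟩ := hc'
  refine ⟨fun ε => B (d ε) (c' 0) + B (c ε) (d' ε), add_mem (bilin_mem_polynomialCurves B hd
    (const_mem_polynomialCurves _)) (bilin_mem_polynomialCurves B hpoly hd'), rfl, fun ε => ?_⟩
  have hdecomp : B (c ε) (c' 0) = B (c 0) (c' 0) + ε • B (d ε) (c' 0) := by
    rw [hcd, LinearMap.map_add₂, LinearMap.map_smul₂]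
  simp only [hcd' ε, map_add, map_smul, hdecomp, smul_add, add_assoc]

lemma hasDerivAt {E : Type*} [NormedAddCommGroup E] [NormedSpace ℝ E] (φ : P →ₗ[ℝ] E)
    (hc : HasTangent c w) : HasDerivAt (fun ε => φ (c ε)) (φ w) 0 := by
  obtain ⟨d, hd, rfl, hcd⟩ := hc
  rw [hasDerivAt_iff_tendsto_slope_zero]
  refine ((continuous_apply_polynomialCurves φ hd).tendsto 0).mono_left nhdsWithin_le_nhds
    |>.congr' ?_
  filter_upwards [self_mem_nhdsWithin] with ε hε
  rw [zero_add, hcd ε, map_add, map_smul, add_sub_cancel_left, inv_smul_smul₀ hε]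

lemma unique (hw : HasTangent c w) (hw' : HasTangent c w') : w = w' := by
  rw [← sub_eq_zero, ← Module.forall_dual_apply_eq_zero_iff ℝ]
  intro φ
  rw [map_sub, (hw.hasDerivAt φ).unique (hw'.hasDerivAt φ), sub_self]

end HasTangent

variable {B : P →ₗ[ℝ] P →ₗ[ℝ] P} {L : P →ₗ[ℝ] P}

/-- `F` is a polynomial in the identity with respect to the product `B` and the linear map `L`, and
`T` is its derivative. -/
inductive HasPolynomialDerivative (B : P →ₗ[ℝ] P →ₗ[ℝ] P) (L : P →ₗ[ℝ] P) :
    (P → P) → (P → P →ₗ[ℝ] P) → Prop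
  | id : HasPolynomialDerivative B L id fun _ => LinearMap.id
  | add {F F' : P → P} {T T' : P → P →ₗ[ℝ] P} : HasPolynomialDerivative B L F T →
      HasPolynomialDerivative B L F' T' → HasPolynomialDerivative B L (F + F') (T + T')
  | smul (r : ℝ) {F : P → P} {T : P → P →ₗ[ℝ] P} : HasPolynomialDerivative B L F T →
      HasPolynomialDerivative B L (r • F) (r • T)
  | bilin {F F' : P → P} {T T' : P → P →ₗ[ℝ] P} : HasPolynomialDerivative B L F T →
      HasPolynomialDerivative B L F' T' → HasPolynomialDerivative B L (fun A => B (F A) (F' A))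
        fun A => (B.flip (F' A)).comp (T A) + (B (F A)).comp (T' A)
  | map {F : P → P} {T : P → P →ₗ[ℝ] P} : HasPolynomialDerivative B L F T →
      HasPolynomialDerivative B L (fun A => L (F A)) fun A => L.comp (T A)

namespace HasPolynomialDerivative

variable {F F' : P → P} {T T' : P → P →ₗ[ℝ] P}

lemma hasTangent (hF : HasPolynomialDerivative B L F T) (A v : P) :
    HasTangent (fun ε : ℝ => F (A + ε • v)) (T A v) := by
  induction hF with
  | id => exact ⟨fun _ => v, const_mem_polynomialCurves v, rfl, fun ε => by simp⟩
  | add _ _ h h' => exact h.add h'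
  | smul r _ h => exact h.smul r
  | bilin _ _ h h' => simpa using! h.bilin B h'
  | map _ h => exact h.map L

lemma unique (hF : HasPolynomialDerivative B L F T) (hF' : HasPolynomialDerivative B L F T') :
    T = T' :=
  funext fun A => LinearMap.ext fun v => (hF.hasTangent A v).unique (hF'.hasTangent A v)

lemma comm (hF : HasPolynomialDerivative B L F T) {φ : P →ₗ[ℝ] P}
    (hB : ∀ v w, B (φ v) w = φ (B v w)) (hB' : ∀ v w, B v (φ w) = φ (B v w))
    (hL : ∀ v, L (φ v) = φ (L v)) (A v : P) : T A (φ v) = φ (T A v) := by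
  induction hF with
  | id => rfl
  | add _ _ h h' => simp [h, h']
  | smul r _ h => simp [h]
  | bilin _ _ h h' => simp [h, h', hB, hB']
  | map _ h => simp [h, hL]

lemma exists_directional {U : P → P} (hF : HasPolynomialDerivative B L F T)
    (hU : ∃ R, HasPolynomialDerivative B L U R) :
    ∃ R, HasPolynomialDerivative B L (fun A => T A (U A)) R := by
  induction hF with
  | id => exact hU
  | add _ _ h h' => exact ⟨_, h.choose_spec.add h'.choose_spec⟩
  | smul r _ h => exact ⟨_, h.choose_spec.smul r⟩
  | bilin hF hF' h h' =>
    exact ⟨_, (h.choose_spec.bilin hF').add (hF.bilin h'.choose_spec)⟩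
  | map _ h => exact ⟨_, h.choose_spec.map⟩

end HasPolynomialDerivative

/-- The maps that are polynomials in the identity with respect to the product `B` and the linear
map `L`. -/
def polynomialMaps (B : P →ₗ[ℝ] P →ₗ[ℝ] P) (L : P →ₗ[ℝ] P) : Submodule ℝ (P → P) where
  carrier := {F | ∃ T, HasPolynomialDerivative B L F T}
  zero_mem' := ⟨_, zero_smul ℝ (_root_.id : P → P) ▸ HasPolynomialDerivative.id.smul 0⟩
  add_mem' := fun ⟨_, h⟩ ⟨_, h'⟩ => ⟨_, h.add h'⟩
  smul_mem' := fun r _ ⟨_, h⟩ => ⟨_, h.smul r⟩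

namespace polynomialMaps

/-- The derivative of a polynomial map. -/
def derivative : polynomialMaps B L →ₗ[ℝ] P → P →ₗ[ℝ] P where
  toFun F := F.2.choose
  map_add' F F' := (F + F').2.choose_spec.unique (F.2.choose_spec.add F'.2.choose_spec)
  map_smul' r F := (r • F).2.choose_spec.unique (F.2.choose_spec.smul r)

lemma hasPolynomialDerivative (F : polynomialMaps B L) :
    HasPolynomialDerivative B L F.1 (derivative F) :=
  F.2.choose_spec

/-- The identity as a polynomial map. -/
def identity : polynomialMaps B L := ⟨id, _, .id⟩

lemma derivative_identity (A v : P) : derivative (identity : polynomialMaps B L) A v = v := by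
  rw [(hasPolynomialDerivative identity).unique .id, LinearMap.id_apply]

/-- The directional derivative of `F` in the direction of the vector field `U`. -/
def directional : polynomialMaps B L →ₗ[ℝ] polynomialMaps B L →ₗ[ℝ] polynomialMaps B L :=
  LinearMap.mk₂ ℝ (fun U F => ⟨fun A => derivative F A (U.1 A),
      (hasPolynomialDerivative F).exists_directional U.2⟩)
    (fun _ _ F => Subtype.ext (funext fun A => map_add (derivative F A) _ _))
    (fun r _ F => Subtype.ext (funext fun A => map_smul (derivative F A) r _))
    (fun U F F' => Subtype.ext (funext fun A =>
      congrArg (fun T => T A (U.1 A)) (map_add derivative F F')))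
    (fun r U F => Subtype.ext (funext fun A =>
      congrArg (fun T => T A (U.1 A)) (map_smul derivative r F)))

lemma directional_identity (U : polynomialMaps B L) : directional U identity = U :=
  Subtype.ext (funext fun A => derivative_identity A (U.1 A))

/-- The product of polynomial maps. -/
def product : polynomialMaps B L →ₗ[ℝ] polynomialMaps B L →ₗ[ℝ] polynomialMaps B L :=
  LinearMap.mk₂ ℝ (fun F F' => ⟨fun A => B (F.1 A) (F'.1 A),
      _, (hasPolynomialDerivative F).bilin (hasPolynomialDerivative F')⟩)
    (fun _ _ _ => Subtype.ext (funext fun _ => LinearMap.map_add₂ B _ _ _))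
    (fun _ _ _ => Subtype.ext (funext fun _ => LinearMap.map_smul₂ B _ _ _))
    (fun _ _ _ => Subtype.ext (funext fun _ => map_add (B _) _ _))
    (fun _ _ _ => Subtype.ext (funext fun _ => map_smul (B _) _ _))

/-- Composition of `L` with a polynomial map. -/
def compLeft : polynomialMaps B L →ₗ[ℝ] polynomialMaps B L where
  toFun F := ⟨fun A => L (F.1 A), _, (hasPolynomialDerivative F).map⟩
  map_add' _ _ := Subtype.ext (funext fun _ => map_add L _ _)
  map_smul' _ _ := Subtype.ext (funext fun _ => map_smul L _ _)

lemma directional_compLeft (U F : polynomialMaps B L) :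
    directional U (compLeft F) = compLeft (directional U F) := by
  refine Subtype.ext (funext fun A => ?_)
  change derivative (compLeft F) A (U.1 A) = L (derivative F A (U.1 A))
  rw [(hasPolynomialDerivative (compLeft F)).unique (hasPolynomialDerivative F).map]
  rfl

end polynomialMaps

end PolynomialMaps

/-! ### Series of potentials -/

section Resummation

open PowerSeries

variable {n : Type} [Fintype n] [DecidableEq n] {D : StringDistribution}
  {𝔤 : Submodule ℝ (Matrix n n ℂ)} {N : Type*}

lemma eq_sumSeries {u : N → MatSeries n} {d : (ℕ → N) → MatSeries n}
    (hd : ∀ a, d a = u (a 0) + X * d fun k => a (k + 1)) (a : ℕ → N) :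
    d a = sumSeries fun k => u (a k) := by
  ext1 m
  induction m generalizing a with
  | zero => rw [hd, sumSeries_eq_add, map_add, map_add, coeff_zero_X_mul, coeff_zero_X_mul]
  | succ m ih =>
    rw [hd, sumSeries_eq_add, map_add, map_add, coeff_succ_X_mul, coeff_succ_X_mul, ih]

/-- Multiplication of potentials by the coupling constant. -/
def mulX : potentials D 𝔤 →ₗ[ℝ] potentials D 𝔤 where
  toFun v := ⟨fun μ => X * v.1 μ, X_mul_mem_fieldsWithCoeffs v.2⟩
  map_add' _ _ := Subtype.ext (funext fun _ => mul_add _ _ _)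
  map_smul' r _ := Subtype.ext (funext fun _ => mul_smul_comm r _ _)

/-- The potential `∑_k g^k a_k`. -/
def sumPot : (ℕ → potentials D 𝔤) →ₗ[ℝ] potentials D 𝔤 where
  toFun a :=
    ⟨fun μ => sumSeries fun k => (a k).1 μ, sumSeries_mem_fieldsWithCoeffs fun k => (a k).2⟩
  map_add' a b := Subtype.ext <| funext fun μ => PowerSeries.ext fun m => by
    simp [coeff_sumSeries, Finset.sum_add_distrib]
  map_smul' r a := Subtype.ext <| funext fun μ => PowerSeries.ext fun m => by
    simp [coeff_sumSeries, Finset.smul_sum]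

lemma sumPot_eq_add (a : ℕ → potentials D 𝔤) :
    sumPot a = a 0 + mulX (sumPot fun k => a (k + 1)) :=
  Subtype.ext (funext fun μ => sumSeries_eq_add fun k => (a k).1 μ)

lemma eq_sumPot {u : N → potentials D 𝔤} {d : (ℕ → N) → potentials D 𝔤}
    (hd : ∀ a, d a = u (a 0) + mulX (d fun k => a (k + 1))) (a : ℕ → N) :
    d a = sumPot fun k => u (a k) :=
  Subtype.ext <| funext fun μ => eq_sumSeries (u := fun b => (u b).1 μ) (d := fun a => (d a).1 μ)
    (fun a => congrArg (fun v => v.1 μ) (hd a)) a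

lemma sumPot_delay (a : ℕ → potentials D 𝔤) : sumPot (delay a) = mulX (sumPot a) := by
  rw [sumPot_eq_add, delay_zero, zero_add]
  rfl

lemma map_sumPot (φ : potentials D 𝔤 →ₗ[ℝ] potentials D 𝔤) (hφ : ∀ v, φ (mulX v) = mulX (φ v))
    (a : ℕ → potentials D 𝔤) : φ (sumPot a) = sumPot fun k => φ (a k) :=
  eq_sumPot (u := φ) (d := fun a => φ (sumPot a))
    (fun a => by rw [sumPot_eq_add, map_add, hφ]) a

lemma sumPot_sumPot (a : ℕ → ℕ → potentials D 𝔤) : sumPot (fun m => sumPot (a m)) =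
    sumPot fun j => ∑ p ∈ Finset.HasAntidiagonal.antidiagonal j, a p.2 p.1 := by
  refine (eq_sumPot (u := sumPot) (d := fun a => sumPot fun j =>
    ∑ p ∈ Finset.HasAntidiagonal.antidiagonal j, a p.2 p.1) (fun a => ?_) a).symm
  rw [← sumPot_delay, ← map_add]
  congr 1
  funext j
  cases j with
  | zero => simp [delay_zero]
  | succ j => rw [Finset.Nat.sum_antidiagonal_succ', Pi.add_apply, delay_succ, add_comm]

lemma formalSum_sumPot {x : ℕ → ℕ → potentials D 𝔤} (hx : ∀ k j, j < k → x k j = 0) (μ : Fin 4) :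
    formalSum (fun k => (sumPot (x k)).1 μ) =
      (sumPot fun j => ∑ k ∈ Finset.range (j + 1), x k j).1 μ := by
  ext1 m
  simp only [sumPot, LinearMap.coe_mk, AddHom.coe_mk, formalSum, coeff_mk, coeff_sumSeries]
  rw [Finset.sum_comm]
  refine Finset.sum_congr rfl fun p hp => ?_
  have hle : p.1 ≤ m := Finset.HasAntidiagonal.antidiagonal.fst_le hp
  rw [Submodule.coe_sum, Finset.sum_apply, map_sum]
  refine (Finset.sum_subset (Finset.range_subset_range.mpr (Nat.succ_le_succ hle))
    fun k _ hk => ?_).symm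
  rw [hx k p.1 (by simpa using hk)]
  exact map_zero (coeff p.2)

end Resummation

section FieldOperations

open PowerSeries

variable {n : Type} [Fintype n] [DecidableEq n] {D : StringDistribution}
  {𝔤 : Submodule ℝ (Matrix n n ℂ)}

lemma commutatorMap_add {R : Type*} [Ring R] [Algebra ℂ R] (u v w : R) :
    commutatorMap (u + v) w = commutatorMap u w + commutatorMap v w := by
  simp only [commutatorMap_apply, add_mul, mul_add, add_sub_add_comm]

lemma commutatorMap_smul {R : Type*} [Ring R] [Algebra ℂ R] (c : ℂ) (u v : R) :
    commutatorMap (c • u) v = c • commutatorMap u v := by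
  simp only [commutatorMap_apply, smul_mul_assoc, mul_smul_comm, smul_sub]

lemma commutatorMap_X_mul {R : Type*} [Ring R] [Algebra ℂ R] (u v : R⟦X⟧) :
    commutatorMap (X * u) v = X * commutatorMap u v := by
  simp only [commutatorMap_apply, mul_sub, ← mul_assoc, (commute_X v).eq]

lemma stringSeries_add_val (v w : potentials D 𝔤) :
    stringSeries D (v + w).1 = stringSeries D v.1 + stringSeries D w.1 :=
  stringSeries_add (IsPotential.rapid v.2) (IsPotential.rapid w.2)

lemma stringSeries_smul_val (r : ℝ) (v : potentials D 𝔤) :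
    stringSeries D (r • v).1 = (r : ℂ) • stringSeries D v.1 := by
  simpa only [Complex.coe_smul] using! stringSeries_smul (r : ℂ) (IsPotential.rapid v.2)

lemma stringSeries_mem_smoothSeries (v : potentials D 𝔤) :
    stringSeries D v.1 ∈ smoothSeries n :=
  mem_smoothSeries_of_mem_rapidSeries (IsPotential.string v.2).rapid

/-- The map `v ↦ ∂ I_c(v)`. -/
def gradString : potentials D 𝔤 →ₗ[ℝ] potentials D 𝔤 where
  toFun v := ⟨fun μ => pdSeries μ (stringSeries D v.1), (IsPotential.string v.2).grad⟩
  map_add' v w := Subtype.ext <| funext fun μ =>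
    (congrArg (pdSeries μ) (stringSeries_add_val v w)).trans
      ((pdSmooth μ).map_add ⟨_, stringSeries_mem_smoothSeries v⟩
        ⟨_, stringSeries_mem_smoothSeries w⟩)
  map_smul' r v := Subtype.ext <| funext fun μ =>
    (congrArg (pdSeries μ) (stringSeries_smul_val r v)).trans
      (pdSeries_smul r (stringSeries_mem_smoothSeries v) μ)

lemma gradString_mulX (v : potentials D 𝔤) : gradString (mulX v) = mulX (gradString v) :=
  Subtype.ext <| funext fun μ =>
    (congrArg (pdSeries μ) (stringSeries_X_mul v.1)).trans (pdSeries_X_mul _ μ)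

/-- The bilinear map `(v, w) ↦ i[I_c(v), w]`. -/
def adString (h𝔤 : IsBracketClosed 𝔤) :
    potentials D 𝔤 →ₗ[ℝ] potentials D 𝔤 →ₗ[ℝ] potentials D 𝔤 :=
  LinearMap.mk₂ ℝ
    (fun v w => ⟨fun μ => commutatorMap (Complex.I • stringSeries D v.1) (w.1 μ),
      IsPotential.bracket h𝔤 (IsPotential.string v.2) w.2⟩)
    (fun v v' w => Subtype.ext <| funext fun μ => by
      change commutatorMap (Complex.I • stringSeries D (v + v').1) (w.1 μ) = _
      rw [stringSeries_add_val, smul_add, commutatorMap_add]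
      rfl)
    (fun r v w => Subtype.ext <| funext fun μ => by
      change commutatorMap (Complex.I • stringSeries D (r • v).1) (w.1 μ) = _
      rw [stringSeries_smul_val, smul_comm, commutatorMap_smul]
      rfl)
    (fun _ _ _ => Subtype.ext <| funext fun _ => map_add (commutatorMap _) _ _)
    (fun r _ _ => Subtype.ext <| funext fun _ => map_smul (commutatorMap _) (r : ℂ) _)

lemma adString_mulX_left (h𝔤 : IsBracketClosed 𝔤) (v w : potentials D 𝔤) :
    adString h𝔤 (mulX v) w = mulX (adString h𝔤 v w) :=
  Subtype.ext <| funext fun μ => by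
    change commutatorMap (Complex.I • stringSeries D fun μ => X * v.1 μ) (w.1 μ) = _
    rw [stringSeries_X_mul, ← mul_smul_comm, commutatorMap_X_mul]
    rfl

lemma adString_mulX_right (h𝔤 : IsBracketClosed 𝔤) (v w : potentials D 𝔤) :
    adString h𝔤 v (mulX w) = mulX (adString h𝔤 v w) :=
  Subtype.ext <| funext fun _ => commutatorMap_pow_X_mul _ _ 1

lemma adString_pow_apply (h𝔤 : IsBracketClosed 𝔤) (v w : potentials D 𝔤) (k : ℕ) (μ : Fin 4) :
    ((adString h𝔤 v ^ k) w).1 μ =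
      (commutatorMap (Complex.I • stringSeries D v.1) ^ k) (w.1 μ) := by
  induction k with
  | zero => rfl
  | succ k ih =>
    rw [pow_succ', pow_succ', Module.End.mul_apply, Module.End.mul_apply, ← ih]
    rfl

end FieldOperations

section Evaluation

variable {n : Type} [Fintype n] [DecidableEq n] {D : StringDistribution}
  {𝔤 : Submodule ℝ (Matrix n n ℂ)} {h𝔤 : IsBracketClosed 𝔤}

/-- The vector fields that are generated by `A`, `(v, w) ↦ i[I_c(v), w]` and `v ↦ ∂ I_c(v)`, as
polynomials in the potential. -/
abbrev polynomialFields (D : StringDistribution) (h𝔤 : IsBracketClosed 𝔤) :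
    Submodule ℝ (potentials D 𝔤 → potentials D 𝔤) :=
  polynomialMaps (adString h𝔤) gradString

/-- The value `∑_k g^k x_k[A]` of a series of fields at the potential `A`. -/
def evalSeries (A : potentials D 𝔤) :
    (ℕ → polynomialFields D h𝔤) →ₗ[ℝ] potentials D 𝔤 :=
  sumPot ∘ₗ (LinearMap.proj A ∘ₗ (polynomialFields D h𝔤).subtype).compLeft ℕ

variable (A : potentials D 𝔤)

lemma evalSeries_apply (x : ℕ → polynomialFields D h𝔤) :
    evalSeries A x = sumPot fun k => (x k).1 A := rfl

lemma evalSeries_delay (x : ℕ → polynomialFields D h𝔤) :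
    evalSeries A (delay x) = mulX (evalSeries A x) := by
  rw [evalSeries_apply, evalSeries_apply, ← sumPot_delay]
  congr 1
  funext k
  cases k <;> rfl

lemma evalSeries_single_zero (F : polynomialFields D h𝔤) :
    evalSeries A (Pi.single 0 F) = F.1 A := by
  rw [evalSeries_apply, sumPot_eq_add, Pi.single_eq_same]
  have hshift : (fun k => (Pi.single (M := fun _ => polynomialFields D h𝔤) 0 F (k + 1)).1 A) = 0 :=
    funext fun k => by rw [Pi.single_eq_of_ne k.succ_ne_zero]; rfl
  rw [hshift, map_zero, map_zero, add_zero]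

lemma evalSeries_convolution
    (β : polynomialFields D h𝔤 →ₗ[ℝ] polynomialFields D h𝔤 →ₗ[ℝ] polynomialFields D h𝔤)
    (φ : polynomialFields D h𝔤 → potentials D 𝔤 →ₗ[ℝ] potentials D 𝔤)
    (hφ : ∀ F v, φ F (mulX v) = mulX (φ F v)) (hβ : ∀ U F, (β U F).1 A = φ F (U.1 A))
    (a x : ℕ → polynomialFields D h𝔤) :
    evalSeries A (convolution β a x) = sumPot fun k => φ (x k) (evalSeries A a) := by
  simp only [evalSeries_apply, fun k => map_sumPot (φ (x k)) (hφ (x k)), sumPot_sumPot, ← hβ]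
  congr 1
  funext m
  rw [convolution_apply, Submodule.coe_sum, Finset.sum_apply]

lemma evalSeries_convolution_product (a x : ℕ → polynomialFields D h𝔤) :
    evalSeries A (convolution polynomialMaps.product a x) =
      adString h𝔤 (evalSeries A a) (evalSeries A x) := by
  rw [evalSeries_convolution A _ (fun F => (adString h𝔤).flip (F.1 A))
    (fun F v => by simp only [LinearMap.flip_apply, adString_mulX_left]) fun _ _ => rfl,
    evalSeries_apply A x,
    map_sumPot _ (adString_mulX_right h𝔤 _)]
  rfl

lemma derivative_mulX (F : polynomialFields D h𝔤) (v : potentials D 𝔤) :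
    polynomialMaps.derivative F A (mulX v) = mulX (polynomialMaps.derivative F A v) :=
  (polynomialMaps.hasPolynomialDerivative F).comm (adString_mulX_left h𝔤) (adString_mulX_right h𝔤)
    gradString_mulX A v

lemma evalSeries_convolution_directional (a x : ℕ → polynomialFields D h𝔤) :
    evalSeries A (convolution polynomialMaps.directional a x) =
      sumPot fun k => polynomialMaps.derivative (x k) A (evalSeries A a) :=
  evalSeries_convolution A _ (fun F => polynomialMaps.derivative F A) (derivative_mulX A)
    (fun _ _ => rfl) a x

lemma evalSeries_convolution_product_pow (a x : ℕ → polynomialFields D h𝔤) (k : ℕ) :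
    evalSeries A ((convolution polynomialMaps.product a ^ k) x) =
      (adString h𝔤 (evalSeries A a) ^ k) (evalSeries A x) := by
  rw [Module.End.pow_apply, Module.End.pow_apply]
  exact Function.Semiconj.iterate_right (f := evalSeries A) (evalSeries_convolution_product A a) k x

lemma evalSeries_compLeft (x : ℕ → polynomialFields D h𝔤) :
    evalSeries A (fun k => polynomialMaps.compLeft (x k)) = gradString (evalSeries A x) :=
  (map_sumPot gradString gradString_mulX _).symm

lemma evalSeries_operatorSeries (c : ℕ → ℝ) {T : Module.End ℝ (ℕ → polynomialFields D h𝔤)}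
    {x : ℕ → polynomialFields D h𝔤} (hT : ∀ k m, m < k → (T ^ k) x m = 0) (μ : Fin 4) :
    (evalSeries A (operatorSeries c T x)).1 μ =
      formalSum fun k => c k • (evalSeries A ((T ^ k) x)).1 μ := by
  have hzero : ∀ k m, m < k → (c k • (T ^ k) x m).1 A = 0 := fun k m hm => by
    rw [hT k m hm, smul_zero]
    rfl
  have hsmul : ∀ k, c k • (evalSeries A ((T ^ k) x)).1 μ =
      (sumPot fun m => (c k • (T ^ k) x m).1 A).1 μ := fun k =>
    (congrArg (fun v => v.1 μ) (map_smul (evalSeries A) (c k) ((T ^ k) x))).symm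
  rw [funext hsmul, formalSum_sumPot hzero]
  simp only [evalSeries_apply, operatorSeries, Submodule.coe_sum, Finset.sum_apply]

end Evaluation

/-! ### The obstruction map on series of polynomial fields -/

section Obstruction

open PowerSeries

variable {n : Type} [Fintype n] [DecidableEq n] {D : StringDistribution}
  {𝔤 : Submodule ℝ (Matrix n n ℂ)} {h𝔤 : IsBracketClosed 𝔤}

/-- The matrix entries at `y` of the order `g^m` of a potential, as linear functionals. -/
def entry (m : ℕ) (μ : Fin 4) (y : Spacetime) (i j : n) : potentials D 𝔤 →ₗ[ℝ] ℂ where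
  toFun v := coeff m (v.1 μ) y i j
  map_add' _ _ := rfl
  map_smul' _ _ := rfl

lemma entry_sumPot (a : ℕ → potentials D 𝔤) (m : ℕ) (μ : Fin 4) (y : Spacetime) (i j : n) :
    entry m μ y i j (sumPot a) =
      ∑ p ∈ Finset.HasAntidiagonal.antidiagonal m, entry p.2 μ y i j (a p.1) := by
  change coeff m (sumSeries fun k => (a k).1 μ) y i j = _
  rw [coeff_sumSeries, Finset.sum_apply, Matrix.sum_apply]
  rfl

lemma hasDerivAt_entry_evalSeries (x : ℕ → polynomialFields D h𝔤) (A v : potentials D 𝔤)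
    (m : ℕ) (μ : Fin 4) (y : Spacetime) (i j : n) :
    HasDerivAt (fun ε : ℝ => entry m μ y i j (evalSeries (A + ε • v) x))
      (entry m μ y i j (sumPot fun k => polynomialMaps.derivative (x k) A v)) 0 := by
  simp only [evalSeries_apply, entry_sumPot]
  exact HasDerivAt.fun_sum fun p _ =>
    ((polynomialMaps.hasPolynomialDerivative (x p.1)).hasTangent A v).hasDerivAt _

variable {α X : VectorField n} {a x : ℕ → polynomialFields D h𝔤}

lemma obstruction_evalSeries (hα : ∀ A : potentials D 𝔤, α A.1 = (evalSeries A a).1)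
    (hX : ∀ A : potentials D 𝔤, X A.1 = (evalSeries A x).1) (A : potentials D 𝔤) :
    obstruction α X A.1 = (evalSeries A (convolution polynomialMaps.directional a x)).1 := by
  rw [evalSeries_convolution_directional]
  funext μ
  ext m y i j
  rw [obstruction, coeff_mk, Matrix.of_apply, hα]
  have hcurve (ε : ℝ) : coeff m (X (A.1 + ε • (evalSeries A a).1) μ) y i j =
      entry m μ y i j (evalSeries (A + ε • evalSeries A a) x) :=
    congrArg (fun v : Fin 4 → MatSeries n => coeff m (v μ) y i j)
      (hX (A + ε • evalSeries A a))
  simp only [hcurve]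
  exact (hasDerivAt_entry_evalSeries x A (evalSeries A a) m μ y i j).deriv

lemma obstruction_iterate_evalSeries (hα : ∀ A : potentials D 𝔤, α A.1 = (evalSeries A a).1)
    (hX : ∀ A : potentials D 𝔤, X A.1 = (evalSeries A x).1) (k : ℕ) (A : potentials D 𝔤) :
    (obstruction α)^[k] X A.1 =
      (evalSeries A ((convolution polynomialMaps.directional a ^ k) x)).1 := by
  induction k generalizing A with
  | zero => exact hX A
  | succ k ih =>
    rw [Function.iterate_succ_apply', obstruction_evalSeries hα ih, pow_succ', Module.End.mul_apply]

lemma inv_factorial_smul {E : Type*} [AddCommGroup E] [Module ℂ E] (k : ℕ) (v : E) :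
    (k.factorial : ℂ)⁻¹ • v = expCoeff k • v := by
  rw [← Complex.coe_smul, expCoeff, Complex.ofReal_inv, Complex.ofReal_natCast]

lemma expObstruction_evalSeries
    (hα : ∀ A : potentials D 𝔤, α A.1 = (evalSeries A (delay a)).1)
    (hX : ∀ A : potentials D 𝔤, X A.1 = (evalSeries A x).1) (A : potentials D 𝔤) :
    expObstruction α X A.1 = (evalSeries A
      (operatorSeries expCoeff (convolution polynomialMaps.directional (delay a)) x)).1 := by
  funext μ
  rw [evalSeries_operatorSeries A _ fun _ _ => convolution_delay_pow_eq_zero a x]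
  ext1 m
  rw [expObstruction, formalSum, coeff_mk, coeff_mk]
  refine Finset.sum_congr rfl fun k _ => ?_
  rw [obstruction_iterate_evalSeries hα hX, inv_factorial_smul]
  rfl

end Obstruction

/-! ### Polynomial fields and the spaces of fields -/

section FieldSpaces

open PowerSeries

variable {n : Type} [Fintype n] [DecidableEq n] {D : StringDistribution}
  {𝔤 : Submodule ℝ (Matrix n n ℂ)} {A : Fin 4 → MatSeries n} {s : ScalarField n}
  {v : VectorField n}

lemma InV.isPotential (h𝔤 : IsBracketClosed 𝔤) (hv : InV D v) (hA : IsPotential D 𝔤 A) :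
    IsPotential D 𝔤 (v A) := by
  induction hv with
  | zero => exact (potentials D 𝔤).zero_mem
  | add v w _ _ hv hw => exact (potentials D 𝔤).add_mem hv hw
  | smul r v _ hv => exact (potentials D 𝔤).smul_mem r hv
  | ad_A l hl =>
    exact IsPotential.adChain h𝔤 (v := potentialField) hA
      fun s hs => (hl s hs).isGaugeParameter h𝔤 hA
  | ad_grad l s₀ hl hs₀ =>
    exact IsPotential.adChain h𝔤 (v := gradField s₀) (hs₀.isGaugeParameter h𝔤 hA).grad
      fun s hs => (hl s hs).isGaugeParameter h𝔤 hA

lemma InV.adField (hs : InS D s) (hv : InV D v) : InV D (adField s v) := by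
  have hcons {l : List (ScalarField n)} (hl : ∀ t ∈ l, InS D t) : ∀ t ∈ s :: l, InS D t :=
    List.forall_mem_cons.mpr ⟨hs, hl⟩
  induction hv with
  | zero =>
    have hzero : _root_.adField s (0 : VectorField n) = 0 := funext fun A => by
      rw [adField_eq_commutatorMap]
      exact funext fun _ => map_zero (commutatorMap _)
    rw [hzero]
    exact InV.zero
  | add v w _ _ hv hw =>
    have hadd : _root_.adField s (v + w) = _root_.adField s v + _root_.adField s w :=
      funext fun A => by
        rw [Pi.add_apply]
        simp only [adField_eq_commutatorMap]
        exact funext fun _ => map_add (commutatorMap _) _ _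
    rw [hadd]
    exact hv.add _ _ hw
  | smul r v _ hv =>
    have hsmul : _root_.adField s (r • v) = r • _root_.adField s v := funext fun A => by
      rw [Pi.smul_apply]
      simp only [adField_eq_commutatorMap]
      exact funext fun _ => map_smul (commutatorMap _) (r : ℂ) _
    rw [hsmul]
    exact hv.smul r _
  | ad_A l hl => exact InV.ad_A (s :: l) (hcons hl)
  | ad_grad l s₀ hl hs₀ => exact InV.ad_grad (s :: l) s₀ (hcons hl) hs₀

lemma InV.exists_string (h𝔤 : IsBracketClosed 𝔤) (hv : InV D v) :
    ∃ s, InS D s ∧ ∀ A, IsPotential D 𝔤 A → s A = stringSeries D (v A) := by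
  induction hv with
  | zero =>
    have hzero := stringSeries_smul 0 (rapidFields n D).zero_mem
    exact ⟨0, InS.zero, fun _ _ => by simpa only [zero_smul] using! hzero.symm⟩
  | add v w hv hw ihv ihw =>
    obtain ⟨s, hs, hsv⟩ := ihv
    obtain ⟨t, ht, htw⟩ := ihw
    refine ⟨s + t, InS.add s t hs ht, fun A hA => ?_⟩
    rw [Pi.add_apply, Pi.add_apply, hsv A hA, htw A hA,
      stringSeries_add (hv.isPotential h𝔤 hA).rapid (hw.isPotential h𝔤 hA).rapid]
  | smul r v hv ihv =>
    obtain ⟨s, hs, hsv⟩ := ihv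
    refine ⟨r • s, InS.smul r s hs, fun A hA => ?_⟩
    rw [Pi.smul_apply, Pi.smul_apply, hsv A hA]
    exact (stringSeries_smul_val r (⟨v A, hv.isPotential h𝔤 hA⟩ : potentials D 𝔤)).symm
  | ad_A l hl => exact ⟨_, InS.string_A l hl, fun _ _ => rfl⟩
  | ad_grad l s₀ hl hs₀ =>
    rcases eq_or_ne l [] with rfl | hne
    · refine ⟨(-1 : ℝ) • s₀, InS.smul _ _ hs₀, fun A hA => ?_⟩
      rw [Pi.smul_apply, neg_one_smul]
      exact (stringSeries_grad (hs₀.isGaugeParameter h𝔤 hA).rapid).symm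
    · exact ⟨_, InS.string_grad l s₀ hne hl hs₀, fun _ _ => rfl⟩

variable {h𝔤 : IsBracketClosed 𝔤}

lemma exists_inV_eq (F : polynomialFields D h𝔤) :
    ∃ v : VectorField n, InV D v ∧ ∀ A : potentials D 𝔤, v A.1 = (F.1 A).1 := by
  have hnil : ∀ s ∈ ([] : List (ScalarField n)), InS D s := List.forall_mem_nil _
  obtain ⟨F, T, hF⟩ := F
  induction hF with
  | id => exact ⟨_, InV.ad_A [] hnil, fun _ => rfl⟩
  | add _ _ ihF ihF' =>
    obtain ⟨v, hv, hvF⟩ := ihF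
    obtain ⟨w, hw, hwF'⟩ := ihF'
    exact ⟨v + w, hv.add _ _ hw, fun A => congrArg₂ (· + ·) (hvF A) (hwF' A)⟩
  | smul r _ ihF =>
    obtain ⟨v, hv, hvF⟩ := ihF
    exact ⟨r • v, hv.smul r _, fun A => congrArg (r • ·) (hvF A)⟩
  | bilin _ _ ihF ihF' =>
    obtain ⟨v, hv, hvF⟩ := ihF
    obtain ⟨w, hw, hwF'⟩ := ihF'
    obtain ⟨s, hs, hsv⟩ := hv.exists_string h𝔤
    refine ⟨_, hw.adField hs, fun A => ?_⟩
    rw [adField_eq_commutatorMap, hsv A.1 A.2, hvF, hwF']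
    rfl
  | map _ ihF =>
    obtain ⟨v, hv, hvF⟩ := ihF
    obtain ⟨s, hs, hsv⟩ := hv.exists_string h𝔤
    refine ⟨_, InV.ad_grad [] s hnil hs, fun A => funext fun μ => ?_⟩
    change pdSeries μ (s A.1) = _
    rw [hsv A.1 A.2, hvF]
    rfl

lemma exists_inGSeriesV_eq (a : ℕ → polynomialFields D h𝔤) : ∃ α : VectorField n,
    InGSeriesV D 𝔤 α ∧ ∀ A : potentials D 𝔤, α A.1 = (evalSeries A (delay a)).1 := by
  choose v hv hva using fun k => exists_inV_eq (a k)
  refine ⟨fun A μ => sumSeries fun k => delay v k A μ,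
    ⟨delay v, fun | 0 => InV.zero | k + 1 => hv k, rfl, fun _ _ _ => rfl⟩,
    fun A => funext fun μ => ?_⟩
  change sumSeries (fun k => delay v k A.1 μ) = sumSeries fun k => (delay a k).1 A |>.1 μ
  refine congrArg sumSeries (funext fun k => ?_)
  cases k with
  | zero => rfl
  | succ k => exact congrFun (hva k A) μ

lemma stringSeries_mulX (v : potentials D 𝔤) :
    stringSeries D (mulX v).1 = X * stringSeries D v.1 :=
  stringSeries_X_mul v.1

lemma stringSeries_sumPot (a : ℕ → potentials D 𝔤) :
    stringSeries D (sumPot a).1 = sumSeries fun k => stringSeries D (a k).1 := by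
  have hd (a : ℕ → potentials D 𝔤) : stringSeries D (sumPot a).1 =
      stringSeries D (a 0).1 + X * stringSeries D (sumPot fun k => a (k + 1)).1 := by
    rw [sumPot_eq_add, stringSeries_add_val, stringSeries_mulX]
  exact eq_sumSeries (u := fun v : potentials D 𝔤 => stringSeries D v.1) hd a

lemma exists_inGSeriesS_eq (e : ℕ → polynomialFields D h𝔤) : ∃ γ : ScalarField n,
    InGSeriesS D 𝔤 γ ∧ ∀ A : potentials D 𝔤, γ A.1 = X * stringSeries D (evalSeries A e).1 := by
  choose v hv hve using fun k => exists_inV_eq (e k)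
  choose s hs hsv using fun k => (hv k).exists_string h𝔤
  refine ⟨fun A => sumSeries fun k => delay s k A,
    ⟨delay s, fun | 0 => InS.zero | k + 1 => hs k, rfl, fun _ _ => rfl⟩, fun A => ?_⟩
  have hse (k : ℕ) : s k A.1 = stringSeries D ((e k).1 A).1 := by rw [hsv k A.1 A.2, hve]
  change sumSeries (fun k => delay s k A.1) = _
  rw [sumSeries_eq_add, evalSeries_apply, stringSeries_sumPot]
  simp only [delay_succ, hse]
  exact zero_add _

end FieldSpaces

/-! ### Existence of the dressing -/

section Dressing

open PowerSeries

variable {n : Type} [Fintype n] [DecidableEq n] {D : StringDistribution}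
  {𝔤 : Submodule ℝ (Matrix n n ℂ)} {h𝔤 : IsBracketClosed 𝔤} {γ : ScalarField n}

lemma stringSeries_add_gradString (v : potentials D 𝔤) :
    stringSeries D (v + gradString v).1 = 0 := by
  rw [stringSeries_add_val]
  exact (congrArg _ (stringSeries_grad (IsPotential.string v.2).rapid)).trans (add_neg_cancel _)

lemma stringPotential_eq_add_gradString (A : potentials D 𝔤) :
    stringPotential D A.1 = (A + gradString A).1 := by
  funext μ
  have hA : A.1 ∈ rapidFields n D := IsPotential.rapid A.2
  have hpd : (fun ν => pdSeries μ (A.1 ν)) ∈ rapidFields n D := fun m => by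
    simp only [coeff_pdSeries]
    exact pdMat_mem_rapidVec_of_mem (hA m) μ
  have hAμ : A.1 μ ∈ rapidSeries n D := fun m i j =>
    ⟨D.component_mem _ (hA m i j).1 μ, D.component_mem _ (hA m i j).2 μ⟩
  have hneg := (rapidFields n D).neg_mem (pdSeries_mem_rapidFields hAμ)
  have hF : fieldStrength A.1 μ =
      (fun ν => pdSeries μ (A.1 ν)) + -fun ν => pdSeries ν (A.1 μ) :=
    funext fun ν => sub_eq_add_neg _ _
  have hstring_neg : stringSeries D (-fun ν => pdSeries ν (A.1 μ)) = A.1 μ := by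
    rw [← neg_one_smul ℂ, stringSeries_smul _ (pdSeries_mem_rapidFields hAμ), stringSeries_grad hAμ,
      neg_one_smul, neg_neg]
  rw [stringPotential, hF, stringSeries_add hpd hneg, hstring_neg, ← pdSeries_stringSeries hA,
    add_comm]
  rfl

/-- The dressed potential of the exponent `γ = g I_c(Φ)` is `Φ + ∂ I_c(Φ)` if `Φ = ∑_k g^k e_k`
solves this equation. -/
def IsDressingSeries (e : ℕ → polynomialFields D h𝔤) : Prop :=
  operatorSeries expCoeff (convolution polynomialMaps.product (delay e))
        (Pi.single 0 polynomialMaps.identity) +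
      operatorSeries (fun k => expCoeff (k + 1)) (convolution polynomialMaps.product (delay e))
        (fun k => polynomialMaps.compLeft (e k)) =
    e + fun k => polynomialMaps.compLeft (e k)

lemma adExp_evalSeries (A : potentials D 𝔤) (e x y : ℕ → polynomialFields D h𝔤) (μ : Fin 4) :
    adExp (X * stringSeries D (evalSeries A e).1) ((evalSeries A x).1 μ) ((evalSeries A y).1 μ) =
      (evalSeries A
        (operatorSeries expCoeff (convolution polynomialMaps.product (delay e)) x +
          operatorSeries (fun k => expCoeff (k + 1))
            (convolution polynomialMaps.product (delay e)) y)).1 μ := by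
  have hpow (z : ℕ → polynomialFields D h𝔤) (k : ℕ) :
      (commutatorMap (Complex.I • (X * stringSeries D (evalSeries A e).1)) ^ k)
        ((evalSeries A z).1 μ) =
      (evalSeries A ((convolution polynomialMaps.product (delay e) ^ k) z)).1 μ := by
    rw [evalSeries_convolution_product_pow, adString_pow_apply, evalSeries_delay,
      ← stringSeries_X_mul]
    rfl
  rw [map_add, Submodule.coe_add, Pi.add_apply,
    evalSeries_operatorSeries A _ fun _ _ => convolution_delay_pow_eq_zero e x,
    evalSeries_operatorSeries A _ fun _ _ => convolution_delay_pow_eq_zero e y,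
    ← formalSum_add]
  simp only [adExp, hpow, inv_factorial_smul]
  rfl

lemma IsDressingSeries.dressedPotential_eq {e : ℕ → polynomialFields D h𝔤} (he : IsDressingSeries e)
    {A : potentials D 𝔤} (hγA : γ A.1 = X * stringSeries D (evalSeries A e).1) :
    dressedPotential γ A.1 = (evalSeries A e + gradString (evalSeries A e)).1 := by
  funext μ
  have hA : A.1 μ = (evalSeries A (h𝔤 := h𝔤) (Pi.single 0 polynomialMaps.identity)).1 μ := by
    rw [evalSeries_single_zero]
    rfl
  have hgrad : pdSeries μ (stringSeries D (evalSeries A e).1) =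
      (evalSeries A fun k => polynomialMaps.compLeft (e k)).1 μ := by
    rw [evalSeries_compLeft]
    rfl
  have hG := (IsPotential.string (evalSeries A e).2).rapid
  have hzero := constantCoeff_smul_X_mul Complex.I (stringSeries D (evalSeries A e).1)
  rw [dressedPotential, dressingFactor, hγA,
    ringInverse_eq (expSeries_mul_expSeries_neg hzero) (expSeries_neg_mul_expSeries hzero),
    gaugeTransform_expSeries_neg hG, hgrad, hA, adExp_evalSeries, he, map_add, evalSeries_compLeft]

lemma exists_isDressingSeries (h𝔤 : IsBracketClosed 𝔤) : ∃ e : ℕ → polynomialFields D h𝔤,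
    (∃ e', e = Pi.single 0 polynomialMaps.identity + delay e') ∧ IsDressingSeries e := by
  obtain ⟨e, he', he⟩ := exists_eq_operatorSeries_add (M := polynomialFields D h𝔤)
    polynomialMaps.product polynomialMaps.compLeft (Pi.single 0 polynomialMaps.identity)
  exact ⟨e, he', he⟩

lemma IsDressingSeries.isDressingExponent {e : ℕ → polynomialFields D h𝔤} (he : IsDressingSeries e)
    (hγ : InGSeriesS D 𝔤 γ)
    (hγe : ∀ A : potentials D 𝔤, γ A.1 = X * stringSeries D (evalSeries A e).1) :
    IsDressingExponent D 𝔤 γ := by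
  refine ⟨hγ, fun A hA => ?_⟩
  have hγA := hγe ⟨A, hA⟩
  obtain ⟨U, hU, hval⟩ := (IsPotential.string (evalSeries ⟨A, hA⟩ e).2).exists_unit
  rw [← hγA] at hval
  have hstring : stringSeries D (transformForm U fun μ => X * A μ) = 0 := by
    rw [← X_mul_dressedPotential hU hval, stringSeries_X_mul, he.dressedPotential_eq hγA,
      stringSeries_add_gradString, mul_zero]
  rw [← dressingFactor] at hval
  simpa only [← hval, Ring.inverse_unit] using! hstring

lemma exists_isDressingExponent (h𝔤 : IsBracketClosed 𝔤) :
    ∃ γ : ScalarField n, IsDressingExponent D 𝔤 γ := by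
  obtain ⟨e, -, he⟩ := exists_isDressingSeries (D := D) h𝔤
  obtain ⟨γ, hγ, hγe⟩ := exists_inGSeriesS_eq e
  exact ⟨γ, he.isDressingExponent hγ hγe⟩

/-- The map of polynomial fields that corresponds to `A ↦ A + ∂ I_c(A)`. -/
def addGradString : polynomialFields D h𝔤 →ₗ[ℝ] polynomialFields D h𝔤 :=
  LinearMap.id + polynomialMaps.compLeft

lemma evalSeries_addGradString (A : potentials D 𝔤) (x : ℕ → polynomialFields D h𝔤) :
    evalSeries A (fun k => addGradString (x k)) =
      evalSeries A x + gradString (evalSeries A x) := by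
  rw [← evalSeries_compLeft, ← map_add]
  rfl

lemma convolution_directional_addGradString (a x : ℕ → polynomialFields D h𝔤) :
    (convolution polynomialMaps.directional a fun k => addGradString (x k)) =
      fun k => addGradString (convolution polynomialMaps.directional a x k) := by
  funext m
  simp only [convolution_apply, map_sum]
  refine Finset.sum_congr rfl fun p _ => ?_
  simp only [addGradString, LinearMap.add_apply, LinearMap.id_apply, map_add,
    polynomialMaps.directional_compLeft]

lemma stringPotential_eq_evalSeries (h𝔤 : IsBracketClosed 𝔤) (A : potentials D 𝔤) :
    stringPotential D A.1 = (evalSeries A fun k => addGradString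
      (Pi.single (M := fun _ => polynomialFields D h𝔤) 0 polynomialMaps.identity k)).1 := by
  rw [evalSeries_addGradString, evalSeries_single_zero, stringPotential_eq_add_gradString]
  rfl

lemma exists_expObstruction_stringPotential_eq (e : ℕ → polynomialFields D h𝔤) :
    ∃ α : VectorField n, InGSeriesV D 𝔤 α ∧ ∀ A : potentials D 𝔤,
      expObstruction α (stringPotential D) A.1 =
        (evalSeries A fun k => addGradString
          ((Pi.single 0 polynomialMaps.identity + delay e : ℕ → polynomialFields D h𝔤) k)).1 := by
  obtain ⟨a, ha⟩ := exists_operatorSeries_eq polynomialMaps.directional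
    (polynomialMaps.directional_identity (B := adString h𝔤) (L := gradString (D := D))) e
  obtain ⟨α, hα, hαa⟩ := exists_inGSeriesV_eq a
  refine ⟨α, hα, fun A => ?_⟩
  rw [expObstruction_evalSeries hαa (stringPotential_eq_evalSeries h𝔤),
    operatorSeries_comp_left _ _ (convolution_directional_addGradString _), ha]

lemma IsDressingExponent.exists_generates (hγ : IsDressingExponent D 𝔤 γ)
    (h𝔤 : IsBracketClosed 𝔤) : ∃ α : VectorField n, GeneratesDressing D 𝔤 γ α := by
  obtain ⟨e, ⟨e', he'⟩, he⟩ := exists_isDressingSeries (D := D) h𝔤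
  obtain ⟨γ', hγ', hγ'e⟩ := exists_inGSeriesS_eq e
  have hγe (A : potentials D 𝔤) : γ A.1 = X * stringSeries D (evalSeries A e).1 :=
    ((he.isDressingExponent hγ' hγ'e).unique hγ h𝔤 A.2).trans (hγ'e A)
  obtain ⟨α, hα, hαA⟩ := exists_expObstruction_stringPotential_eq e'
  refine ⟨α, hα, fun A hA => (hαA ⟨A, hA⟩).trans ?_⟩
  rw [← he', evalSeries_addGradString]
  exact (he.dressedPotential_eq (hγe ⟨A, hA⟩)).symm

end Dressing

end

theorem propositionp_general {n : Type} [Fintype n] [DecidableEq n]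
    (𝔤 : Submodule ℝ (Matrix n n ℂ)) (h𝔤 : IsBracketClosed 𝔤) (D : StringDistribution) :
    (∃ γ : ScalarField n, IsDressingExponent D 𝔤 γ) ∧
    ∀ γ : ScalarField n, IsDressingExponent D 𝔤 γ →
      (∀ γ' : ScalarField n, IsDressingExponent D 𝔤 γ' →
        ∀ A, IsPotential D 𝔤 A → γ' A = γ A) ∧
      (∃ α : VectorField n, GeneratesDressing D 𝔤 γ α) ∧
      ∀ l : MatSeries n, IsGaugeParameter D 𝔤 l → ∀ A, IsPotential D 𝔤 A →
        IsPotential D 𝔤 (gaugeTransform (gaugeFunction l) A) ∧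
        dressingFactor γ (gaugeTransform (gaugeFunction l) A) =
          dressingFactor γ A * gaugeFunction l ∧
        dressedPotential γ (gaugeTransform (gaugeFunction l) A) = dressedPotential γ A ∧
        ∀ α : VectorField n, GeneratesDressing D 𝔤 γ α →
          expObstruction α (stringPotential D) (gaugeTransform (gaugeFunction l) A) =
            expObstruction α (stringPotential D) A := by
  refine ⟨exists_isDressingExponent h𝔤, fun γ hγ =>
    ⟨fun γ' hγ' A hA => hγ.unique hγ' h𝔤 hA, hγ.exists_generates h𝔤, fun l hl A hA => ?_⟩⟩
  have hA' := hA.gaugeTransform h𝔤 hl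
  obtain ⟨hfactor, hdressed⟩ := hγ.gauge_covariant h𝔤 hl hA
  exact ⟨hA', hfactor, hdressed, fun α hα => by rw [hα.2 _ hA', hα.2 _ hA, hdressed]⟩

theorem propositionp {n : Type} [Fintype n] [DecidableEq n]
    (𝔤 : Submodule ℝ (Matrix n n ℂ)) (h𝔤 : IsCompactLieAlgebra 𝔤) (D : StringDistribution) :
    (∃ γ : ScalarField n, IsDressingExponent D 𝔤 γ) ∧
    ∀ γ : ScalarField n, IsDressingExponent D 𝔤 γ →
      (∀ γ' : ScalarField n, IsDressingExponent D 𝔤 γ' →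
        ∀ A, IsPotential D 𝔤 A → γ' A = γ A) ∧
      (∃ α : VectorField n, GeneratesDressing D 𝔤 γ α) ∧
      ∀ l : MatSeries n, IsGaugeParameter D 𝔤 l → ∀ A, IsPotential D 𝔤 A →
        IsPotential D 𝔤 (gaugeTransform (gaugeFunction l) A) ∧
        dressingFactor γ (gaugeTransform (gaugeFunction l) A) =
          dressingFactor γ A * gaugeFunction l ∧
        dressedPotential γ (gaugeTransform (gaugeFunction l) A) = dressedPotential γ A ∧
        ∀ α : VectorField n, GeneratesDressing D 𝔤 γ α →
          expObstruction α (stringPotential D) (gaugeTransform (gaugeFunction l) A) =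
            expObstruction α (stringPotential D) A :=
  propositionp_general 𝔤 h𝔤.2 D
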